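/- Let $k$ be a field and let $S\neq 0$ be a finite-dimensional $k$-algebra. All modules are finite-dimensional $S$-modules. Let $L(\lambda)$, $\lambda\in\Lambda$, be a full set of pairwise non-isomorphic simple $S$-modules, let $P(\lambda)$ be the projective cover of $L(\lambda)$, and let $\le$ be a partial order on $\Lambda$. The standard module $\Delta(\lambda)$ is the largest quotient of $P(\lambda)$ all of whose composition factors are of the form $L(\mu)$ with $\mu\le\lambda$. Assume that $S$ is quasi-hereditary with respect to $\le$: for each $\lambda\in\Lambda$, (i) $L(\lambda)$ occurs exactly once as a composition factor of $\Delta(\lambda)$, and (ii) $P(\lambda)$ has a filtration with sections standard modules in which $\Delta(\lambda)$ occurs exactly once and $\Delta(\mu)$ occurs only if $\mu\ge\lambda$. For a nonzero module $X$ the $\nabla$-filtration dimension $\mathrm{gfd}(X)$ is the largest $d$ such that $\mathrm{Ext}^d_S(\Delta(\lambda),X)\neq 0$ for some $\lambda\in\Lambda$; put $\mathrm{gfd}(0)=0$ and $\mathrm{gfd}(S)=\sup_X \mathrm{gfd}(X)$. Let $\mathrm{gl.dim}\,S$ be the global dimension of $S$. Assume that $S$ has a simple-preserving duality, i.e. a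 contravariant self-equivalence $X\mapsto X^\circ$ of the category of finite-dimensional $S$-modules with $L(\lambda)^\circ\cong L(\lambda)$ for all $\lambda$, and that $S$ has property $A$: if $\mu<\lambda$ then $\mathrm{gfd}(L(\mu))\le\mathrm{gfd}(L(\lambda))$. (1) Suppose that $S$ has exactly four simple modules, which can be named $L(0),L(1),L(2),L(3)$ so that their $\nabla$-filtration dimensions are $0,1,1,2$ respectively. Then $\mathrm{Ext}^4_S(L(3),L(3))\neq 0$ and $\mathrm{gl.dim}\,S=2\,\mathrm{gfd}(S)$. Moreover, $\mathrm{Ext}_S^{2d}(M^\circ,M)\neq 0$ for every nonzero module $M$, where $d=\mathrm{gfd}(M)$. (2) Without any assumption on the number of simple modules: if $\mathrm{gl.dim}\,S\neq 2\,\mathrm{gfd}(S)$, then $S$ has at least five simple modules up to isomorphism. -/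

import Mathlib

open CategoryTheory

universe u

noncomputable section

namespace QuasiHereditary

/-- A surjective linear map from a projective module onto `L` with superfluous kernel. -/
structure IsProjectiveCover {S : Type u} [Ring S] {P L : Type u} [AddCommGroup P] [Module S P]
    [AddCommGroup L] [Module S L] (p : P →ₗ[S] L) : Prop where
  projective : Module.Projective S P
  surjective : Function.Surjective p
  superfluous : ∀ N : Submodule S P, N ⊔ LinearMap.ker p = ⊤ → N = ⊤

/-- `M` has a finite filtration `0 = F 0 ≤ F 1 ≤ … ≤ F n = M` whose `t`-th section
`F (t + 1) / F t` is isomorphic to `X (ν t)`. If all `X i` are simple, such a filtration is a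
composition series. -/
def HasFiltration {S : Type u} [Ring S] {Λ : Type*} (X : Λ → FGModuleCat.{u} S)
    (M : Type u) [AddCommGroup M] [Module S M] {n : ℕ} (ν : Fin n → Λ) : Prop :=
  ∃ F : Fin (n + 1) → Submodule S M, Monotone F ∧ F 0 = ⊥ ∧ F (Fin.last n) = ⊤ ∧
    ∀ t : Fin n,
      Nonempty ((F t.succ ⧸ (F t.castSucc).submoduleOf (F t.succ)) ≃ₗ[S] X (ν t))

/-- A full set `L i`, `i ∈ Λ`, of pairwise non-isomorphic simple `S`-modules, together with a
projective cover `P i` of each `L i`. -/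
structure SimpleLabelling (S : Type u) [Ring S] (Λ : Type*) where
  /-- the simple module with label `i` -/
  L : Λ → FGModuleCat.{u} S
  /-- the projective cover of the simple module with label `i` -/
  P : Λ → FGModuleCat.{u} S
  /-- the covering map -/
  cov : ∀ i, P i →ₗ[S] L i
  simple : ∀ i, IsSimpleModule S (L i)
  eq_of_iso : ∀ i j, Nonempty (L i ≃ₗ[S] L j) → i = j
  exists_iso : ∀ (M : Type u) [AddCommGroup M] [Module S M], IsSimpleModule S M →
    ∃ i, Nonempty (M ≃ₗ[S] L i)
  isProjectiveCover : ∀ i, IsProjectiveCover (cov i)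

namespace SimpleLabelling

variable {S : Type u} [Ring S] {Λ : Type*} [PartialOrder Λ] (E : SimpleLabelling S Λ)

/-- `M` has a composition series, all of whose factors are of the form `L j` with `j ≤ i`. -/
def FactorsLE (i : Λ) (M : Type u) [AddCommGroup M] [Module S M] : Prop :=
  ∃ (n : ℕ) (ν : Fin n → Λ), HasFiltration E.L M ν ∧ ∀ t, ν t ≤ i

/-- The standard module `Δ(i)`: the largest quotient of `P i` all of whose composition factors
are `L j` with `j ≤ i`, that is, the quotient by the smallest submodule `N` of `P i` for which
`P i / N` has such factors only. -/
def Δ (i : Λ) : FGModuleCat.{u} S :=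
  FGModuleCat.of S (E.P i ⧸ sInf {N : Submodule S (E.P i) | E.FactorsLE i (E.P i ⧸ N)})

/-- The algebra is quasi-hereditary with respect to the partial order on `Λ`. -/
structure IsQuasiHereditary : Prop where
  /-- `L i` occurs exactly once as a composition factor of `Δ(i)` -/
  simple_once : ∀ i, ∃ (n : ℕ) (ν : Fin n → Λ), HasFiltration E.L (E.Δ i) ν ∧ ∃! t, ν t = i
  /-- `P i` has a filtration by standard modules in which `Δ(i)` occurs exactly once, and
  `Δ(j)` occurs only if `i ≤ j` -/
  standard_filtration : ∀ i, ∃ (n : ℕ) (ν : Fin n → Λ), HasFiltration E.Δ (E.P i) ν ∧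
    (∃! t, ν t = i) ∧ ∀ t, i ≤ ν t

/-- The `∇`-filtration dimension of a finite-dimensional module `M`: the largest `d` such that
`Ext^d(Δ(i), M) ≠ 0` for some `i` (and `0` for the zero module). -/
def gfd (M : FGModuleCat.{u} S) : ℕ∞ :=
  ⨆ (d : ℕ) (_ : ∃ i, Nontrivial (Abelian.Ext (E.Δ i).obj M.obj d)), (d : ℕ∞)

/-- The `∇`-filtration dimension of the algebra. -/
def algGfd : ℕ∞ := ⨆ M : FGModuleCat.{u} S, E.gfd M

/-- Property `A`: the `∇`-filtration dimension of simple modules is weakly increasing. -/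
def PropertyA : Prop := ∀ i j, i < j → E.gfd (E.L i) ≤ E.gfd (E.L j)

end SimpleLabelling

/-- The global dimension of `S`: the supremum of the projective dimensions of the
finitely generated modules. -/
def globalDim (S : Type u) [Ring S] : WithBot ℕ∞ :=
  ⨆ M : FGModuleCat.{u} S, projectiveDimension M.obj

end QuasiHereditary

end

/-!
The theorem holds because, for every quasi-hereditary algebra with a simple-preserving duality
`M ↦ M°`, every nonzero module `M` with `∇`-filtration dimension `d` satisfies
`Ext^{2d}(M°, M) ≠ 0` (`not_extVanish_of_gfd_eq`), and `Ext^n(N°, M) = 0` for `n > gfd N + gfd M`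
(`extVanish_dual_of_gfdLE`). Together these give that the global dimension is always twice the
`∇`-filtration dimension (`globalDim_eq_two_mul_algGfd`), whatever the number of simple modules;
in particular the inequality `gl.dim S ≠ 2 gfd(S)` in the second part never occurs.

Call `Y` good if `Ext^n(Δ(i), Y) = 0` for all `i` and all `n > 0`. The costandard modules are the
duals `Δ(i)°`. They are good, since a nonzero `Ext^n(Δ(i), M)` with `n > 0` forces a composition
factor `L j` of `M` with `j > i`, and since duality makes the vanishing of `Ext¹(Δ(i), Δ(j)°)`
symmetric in `i` and `j`. Universal extensions embed every module `M` in a good module `Y` whose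
cokernel `X = Y / M` has a filtration by standard modules (`exists_approximation`), and the dual of
a good module has a filtration by standard modules (`Good.filt_dual`). If `d > 0`, then the
`∇`-filtration dimension of `X` is `d - 1`, and dimension shifting in both arguments shows that
`Ext^{2d}(M°, M) = 0` would imply `Ext^{2d-2}(X°, X) = 0` when `d ≥ 2`. This reduces everything to
the case `d = 1`.

For `d = 1` choose `0 → M → Y → Q → 0` with `Y` good and `Q` in the left orthogonal of the good
modules, and with `Q` of minimal length. By Fitting's lemma the map `p : Y → Q` is then radical:
`1 - pw` is invertible for all `w : Q → Y`. Moreover `Q` is a tilting module: both `Q` and `Q°` have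
standard and costandard filtrations. Let `L i` be a maximal composition factor of `Q`. Both `Q` and
`Q°` have a standard filtration that starts with `Δ(i)` (`Filt.exists_of_maximal`), and the
inclusions of `Δ(i)` extend to maps `α : Q° → Q` and `β : Q → Q°` with `αβ` the identity on `Δ(i)`.
If `Ext²(M°, M)` were zero, then `α` would be of the form `pu + vp°`, and this would make `1 - αβ`
invertible, a contradiction.
-/

namespace QuasiHereditary

/-! ### Short exact sequences and extension groups -/

section Ext

variable {S : Type u} [Ring S]

/-- A short exact sequence `0 → A → B → C → 0` of finitely generated modules, given by its two
linear maps. -/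
structure IsSES {A B C : FGModuleCat.{u} S} (f : A →ₗ[S] B) (g : B →ₗ[S] C) : Prop where
  inj : Function.Injective f
  exact : Function.Exact f g
  surj : Function.Surjective g

/-- `Ext^n(A, B) = 0`, computed in the category of all modules. -/
abbrev ExtVanish (A B : FGModuleCat.{u} S) (n : ℕ) : Prop :=
  Subsingleton (Abelian.Ext A.obj B.obj n)

namespace IsSES

variable {A B C : FGModuleCat.{u} S} {f : A →ₗ[S] B} {g : B →ₗ[S] C}

/-- A map killed by the second map of a short exact sequence factors through the first one. -/
lemma exists_factor (h : IsSES f g) {X : Type*} [AddCommGroup X] [Module S X] {φ : X →ₗ[S] B}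
    (hφ : g ∘ₗ φ = 0) : ∃ ψ : X →ₗ[S] A, f ∘ₗ ψ = φ := by
  have hr : ∀ x, φ x ∈ LinearMap.range f := fun x => (h.exact _).1 (LinearMap.congr_fun hφ x)
  refine ⟨(LinearEquiv.ofInjective f h.inj).symm.toLinearMap ∘ₗ φ.codRestrict _ hr,
    LinearMap.ext fun x => ?_⟩
  exact congrArg Subtype.val
    ((LinearEquiv.ofInjective f h.inj).apply_symm_apply (φ.codRestrict _ hr x))

/-- The short complex of modules underlying a short exact sequence. -/
noncomputable abbrev shortComplex (h : IsSES f g) : ShortComplex (ModuleCat.{u} S) :=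
  ShortComplex.mk (X₁ := A.obj) (X₂ := B.obj) (X₃ := C.obj) (ModuleCat.ofHom f) (ModuleCat.ofHom g)
    (by ext x; exact h.exact.apply_apply_eq_zero x)

lemma shortExact (h : IsSES f g) : h.shortComplex.ShortExact where
  exact := (ShortComplex.ShortExact.moduleCat_exact_iff_function_exact _).2 h.exact
  mono_f := (ModuleCat.mono_iff_injective _).2 h.inj
  epi_g := (ModuleCat.epi_iff_surjective _).2 h.surj

variable (h : IsSES f g) {X : FGModuleCat.{u} S} {n : ℕ}
include h

lemma ext_covariant₂ (h₁ : ExtVanish X A n) (h₃ : ExtVanish X C n) : ExtVanish X B n := by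
  refine subsingleton_of_forall_eq 0 fun x => ?_
  obtain ⟨y, rfl⟩ := Abelian.Ext.covariant_sequence_exact₂ X.obj h.shortExact x
    (Subsingleton.elim (h := h₃) _ _)
  rw [Subsingleton.elim (h := h₁) y 0, Abelian.Ext.zero_comp]

lemma ext_covariant₃ (h₂ : ExtVanish X B n) (h₁ : ExtVanish X A (n + 1)) : ExtVanish X C n := by
  refine subsingleton_of_forall_eq 0 fun x => ?_
  obtain ⟨y, rfl⟩ := Abelian.Ext.covariant_sequence_exact₃ X.obj h.shortExact x rfl
    (Subsingleton.elim (h := h₁) _ _)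
  rw [Subsingleton.elim (h := h₂) y 0, Abelian.Ext.zero_comp]

lemma ext_covariant₁ (h₃ : ExtVanish X C n) (h₂ : ExtVanish X B (n + 1)) :
    ExtVanish X A (n + 1) := by
  refine subsingleton_of_forall_eq 0 fun x => ?_
  obtain ⟨y, rfl⟩ := Abelian.Ext.covariant_sequence_exact₁ X.obj h.shortExact x
    (Subsingleton.elim (h := h₂) _ _) rfl
  rw [Subsingleton.elim (h := h₃) y 0, Abelian.Ext.zero_comp]

lemma ext_contravariant₂ (h₁ : ExtVanish A X n) (h₃ : ExtVanish C X n) : ExtVanish B X n := by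
  refine subsingleton_of_forall_eq 0 fun x => ?_
  obtain ⟨y, rfl⟩ := Abelian.Ext.contravariant_sequence_exact₂ h.shortExact X.obj x
    (Subsingleton.elim (h := h₁) _ _)
  rw [Subsingleton.elim (h := h₃) y 0, Abelian.Ext.comp_zero]

lemma ext_contravariant₁ (h₂ : ExtVanish B X n) (h₃ : ExtVanish C X (n + 1)) :
    ExtVanish A X n := by
  refine subsingleton_of_forall_eq 0 fun x => ?_
  obtain ⟨y, rfl⟩ := Abelian.Ext.contravariant_sequence_exact₁ h.shortExact X.obj x
    (add_comm 1 n) (Subsingleton.elim (h := h₃) _ _)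
  rw [Subsingleton.elim (h := h₂) y 0, Abelian.Ext.comp_zero]

lemma ext_contravariant₃ (h₁ : ExtVanish A X n) (h₂ : ExtVanish B X (n + 1)) :
    ExtVanish C X (n + 1) := by
  refine subsingleton_of_forall_eq 0 fun x => ?_
  obtain ⟨y, rfl⟩ := Abelian.Ext.contravariant_sequence_exact₃ h.shortExact X.obj x
    (Subsingleton.elim (h := h₂) _ _) (add_comm 1 n)
  rw [Subsingleton.elim (h := h₁) y 0, Abelian.Ext.comp_zero]

lemma exists_lift (hX : ExtVanish X A 1) (φ : X →ₗ[S] C) : ∃ ψ : X →ₗ[S] B, g ∘ₗ ψ = φ := by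
  obtain ⟨y, hy⟩ := Abelian.Ext.covariant_sequence_exact₃ X.obj h.shortExact
    (Abelian.Ext.mk₀ (Y := C.obj) (ModuleCat.ofHom φ)) (n₁ := 1) rfl
    (Subsingleton.elim (h := hX) _ _)
  obtain ⟨ψ, rfl⟩ := (Abelian.Ext.mk₀_bijective _ _).2 y
  rw [Abelian.Ext.mk₀_comp_mk₀] at hy
  have := (Abelian.Ext.mk₀_bijective _ _).1 hy
  exact ⟨ψ.hom, congrArg ModuleCat.Hom.hom this⟩

lemma exists_extend (hX : ExtVanish C X 1) (φ : A →ₗ[S] X) : ∃ ψ : B →ₗ[S] X, ψ ∘ₗ f = φ := by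
  obtain ⟨y, hy⟩ := Abelian.Ext.contravariant_sequence_exact₁ h.shortExact X.obj
    (Abelian.Ext.mk₀ (X := A.obj) (Y := X.obj) (ModuleCat.ofHom φ)) (n₁ := 1) rfl
    (Subsingleton.elim (h := hX) _ _)
  obtain ⟨ψ, rfl⟩ := (Abelian.Ext.mk₀_bijective _ _).2 y
  rw [Abelian.Ext.mk₀_comp_mk₀] at hy
  have := (Abelian.Ext.mk₀_bijective _ _).1 hy
  exact ⟨ψ.hom, congrArg ModuleCat.Hom.hom this⟩

/-- Dimension shifting at degree one: `Ext¹(C, X)` vanishes when `Ext¹(B, X)` does and all maps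
`A → X` extend to `B`. -/
lemma ext_one_of_extend (hB : ExtVanish B X 1)
    (H : ∀ φ : A →ₗ[S] X, ∃ ψ : B →ₗ[S] X, ψ ∘ₗ f = φ) : ExtVanish C X 1 := by
  refine subsingleton_of_forall_eq 0 fun x => ?_
  obtain ⟨y, rfl⟩ := Abelian.Ext.contravariant_sequence_exact₃ h.shortExact X.obj x
    (Subsingleton.elim (h := hB) _ _) (n₀ := 0) rfl
  obtain ⟨φ, rfl⟩ := (Abelian.Ext.mk₀_bijective _ _).2 y
  obtain ⟨ψ, hψ⟩ := H φ.hom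
  let ψ' : h.shortComplex.X₂ ⟶ X.obj := ModuleCat.ofHom ψ
  have : φ = h.shortComplex.f ≫ ψ' := by
    ext x; exact (LinearMap.congr_fun hψ x).symm
  rw [this, ← Abelian.Ext.mk₀_comp_mk₀]
  exact h.shortExact.extClass_comp_assoc _

omit h in
lemma of_equiv_zero (e : A ≃ₗ[S] B) :
    IsSES (C := FGModuleCat.of S PUnit) e.toLinearMap (0 : B →ₗ[S] PUnit.{u + 1}) where
  inj := e.injective
  exact x := ⟨fun _ => e.surjective x, fun _ => rfl⟩
  surj _ := ⟨0, Subsingleton.elim _ _⟩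

omit h in
/-- The short exact sequence given by the kernel of a surjection. -/
lemma of_surjective [IsNoetherianRing S] {g : B →ₗ[S] C} (hg : Function.Surjective g) :
    IsSES (A := FGModuleCat.of S (LinearMap.ker g)) (LinearMap.ker g).subtype g where
  inj := (LinearMap.ker g).subtype_injective
  exact := g.exact_subtype_ker_map
  surj := hg

omit h in
/-- The short exact sequence given by the cokernel of an injection. -/
lemma of_injective {f : A →ₗ[S] B} (hf : Function.Injective f) :
    IsSES (C := FGModuleCat.of S (B ⧸ LinearMap.range f)) f (LinearMap.range f).mkQ where
  inj := hf
  exact := f.exact_map_mkQ_range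
  surj := Submodule.mkQ_surjective _

end IsSES

variable {A B X : FGModuleCat.{u} S} {n : ℕ}

lemma extVanish_of_projective [h : Module.Projective S A] : ExtVanish A X (n + 1) := by
  have : Projective A.obj := (IsProjective.iff_projective A).1 h
  exact subsingleton_of_forall_eq 0 fun x => x.eq_zero_of_projective

lemma extVanish_retract_right (i : A →ₗ[S] B) (r : B →ₗ[S] A) (hr : r ∘ₗ i = LinearMap.id)
    (h : ExtVanish X B n) : ExtVanish X A n := by
  refine subsingleton_of_forall_eq 0 fun x => ?_
  have e : (ModuleCat.ofHom i : A.obj ⟶ B.obj) ≫ (ModuleCat.ofHom r : B.obj ⟶ A.obj) = 𝟙 A.obj := by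
    ext a; exact LinearMap.congr_fun hr a
  rw [← Abelian.Ext.comp_mk₀_id x, ← e, ← Abelian.Ext.mk₀_comp_mk₀,
    ← Abelian.Ext.comp_assoc_of_third_deg_zero,
    Subsingleton.elim (h := h) (x.comp _ _) 0, Abelian.Ext.zero_comp]

lemma extVanish_retract_left (i : A →ₗ[S] B) (r : B →ₗ[S] A) (hr : r ∘ₗ i = LinearMap.id)
    (h : ExtVanish B X n) : ExtVanish A X n := by
  refine subsingleton_of_forall_eq 0 fun x => ?_
  have e : (ModuleCat.ofHom i : A.obj ⟶ B.obj) ≫ (ModuleCat.ofHom r : B.obj ⟶ A.obj) = 𝟙 A.obj := by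
    ext a; exact LinearMap.congr_fun hr a
  rw [← Abelian.Ext.mk₀_id_comp x, ← e, ← Abelian.Ext.mk₀_comp_mk₀_assoc,
    Subsingleton.elim (h := h) ((Abelian.Ext.mk₀ _).comp x _) 0, Abelian.Ext.comp_zero]

lemma extVanish_zero_iff : ExtVanish A B 0 ↔ ∀ φ : A →ₗ[S] B, φ = 0 := by
  constructor
  · intro h φ
    have := (Abelian.Ext.mk₀_bijective _ _).1 (Subsingleton.elim (h := h)
      (Abelian.Ext.mk₀ (X := A.obj) (Y := B.obj) (ModuleCat.ofHom φ)) (Abelian.Ext.mk₀ 0))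
    exact congrArg ModuleCat.Hom.hom this
  · intro h
    refine subsingleton_of_forall_eq 0 fun x => ?_
    obtain ⟨φ, rfl⟩ := (Abelian.Ext.mk₀_bijective _ _).2 x
    rw [show φ = 0 from ModuleCat.hom_ext (h φ.hom), Abelian.Ext.mk₀_zero]

lemma extVanish_of_subsingleton_right (h : Subsingleton A) : ExtVanish X A n := by
  refine subsingleton_of_forall_eq 0 fun x => ?_
  have : 𝟙 A.obj = 0 := by ext a; exact Subsingleton.elim (α := A) _ _
  rw [← Abelian.Ext.comp_mk₀_id x, this, Abelian.Ext.mk₀_zero, Abelian.Ext.comp_zero]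

lemma extVanish_of_subsingleton_left (h : Subsingleton A) : ExtVanish A X n := by
  refine subsingleton_of_forall_eq 0 fun x => ?_
  have : 𝟙 A.obj = 0 := by ext a; exact Subsingleton.elim (α := A) _ _
  rw [← Abelian.Ext.mk₀_id_comp x, this, Abelian.Ext.mk₀_zero, Abelian.Ext.zero_comp]

lemma extVanish_of_equiv_left (e : A ≃ₗ[S] B) (h : ExtVanish A X n) : ExtVanish B X n :=
  extVanish_retract_left e.symm.toLinearMap e.toLinearMap (by ext; simp) h

lemma extVanish_of_equiv_right (e : A ≃ₗ[S] B) (h : ExtVanish X A n) : ExtVanish X B n :=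
  extVanish_retract_right e.symm.toLinearMap e.toLinearMap (by ext; simp) h

end Ext

section Duality

variable {S : Type u} [Ring S]

/-! ### Pushouts, presentations and composition of short exact sequences -/

/-- The pushout of a short exact sequence `0 → K → P → A → 0` along a map `φ : K → M`. -/
lemma IsSES.exists_pushout {K P A M : FGModuleCat.{u} S} {f : K →ₗ[S] P} {g : P →ₗ[S] A}
    (h : IsSES f g) (φ : K →ₗ[S] M) :
    ∃ (E : FGModuleCat.{u} S) (j : M →ₗ[S] E) (q : E →ₗ[S] A) (ψ : P →ₗ[S] E),
      IsSES j q ∧ ψ ∘ₗ f = j ∘ₗ φ ∧ q ∘ₗ ψ = g := by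
  let N : Submodule S (M × P) := LinearMap.range (φ.prod (-f))
  have hN : N ≤ LinearMap.ker (g ∘ₗ LinearMap.snd S M P) := by
    rintro _ ⟨x, rfl⟩
    simp [h.exact.apply_apply_eq_zero]
  refine ⟨FGModuleCat.of S ((M × P) ⧸ N), N.mkQ ∘ₗ LinearMap.inl S M P, N.liftQ _ hN,
    N.mkQ ∘ₗ LinearMap.inr S M P, ⟨?_, ?_, ?_⟩, ?_, ?_⟩
  · refine (injective_iff_map_eq_zero _).2 fun m hm => ?_
    obtain ⟨x, hx⟩ := (Submodule.Quotient.mk_eq_zero N).1 hm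
    have h2 : -f x = 0 := congrArg Prod.snd hx
    have h3 : x = 0 := h.inj (by rw [map_zero, ← neg_eq_zero, h2])
    have h1 : φ x = m := congrArg Prod.fst hx
    rw [← h1, h3, map_zero]
  · intro y
    obtain ⟨⟨m, p⟩, rfl⟩ := N.mkQ_surjective y
    constructor
    · intro hy
      obtain ⟨x, hx⟩ := (h.exact p).1 hy
      refine ⟨m + φ x, (Submodule.Quotient.eq N).2 ⟨x, ?_⟩⟩
      ext <;> simp [hx]
    · rintro ⟨m', hm'⟩
      rw [← hm']
      exact map_zero g
  · intro a
    obtain ⟨p, rfl⟩ := h.surj a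
    exact ⟨N.mkQ (0, p), rfl⟩
  · ext x
    refine (Submodule.Quotient.eq N).2 ⟨-x, ?_⟩
    ext <;> simp
  · rfl

/-- Every finitely generated module has a finitely generated projective presentation. -/
lemma exists_projective_presentation [IsNoetherianRing S] (A : FGModuleCat.{u} S) :
    ∃ (K P : FGModuleCat.{u} S) (f : K →ₗ[S] P) (g : P →ₗ[S] A),
      Module.Projective S P ∧ IsSES f g := by
  obtain ⟨n, g, hg⟩ := Module.Finite.exists_fin' S A
  exact ⟨_, FGModuleCat.of S (Fin n → S), _, g, inferInstanceAs (Module.Projective S (Fin n → S)),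
    IsSES.of_surjective (B := FGModuleCat.of S (Fin n → S)) hg⟩

/-- The third isomorphism theorem for `A ⊆ B ⊆ C`: the sequence `0 → B/A → C/A → C/B → 0`. -/
lemma IsSES.exists_comp {A B C X Y : FGModuleCat.{u} S} {i : A →ₗ[S] B} {p : B →ₗ[S] X}
    {j : B →ₗ[S] C} {q : C →ₗ[S] Y} (h₁ : IsSES i p) (h₂ : IsSES j q) :
    ∃ (Z : FGModuleCat.{u} S) (r : C →ₗ[S] Z) (s : X →ₗ[S] Z) (t : Z →ₗ[S] Y),
      IsSES (j ∘ₗ i) r ∧ IsSES s t := by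
  have hc := IsSES.of_injective (f := j ∘ₗ i) (h₂.inj.comp h₁.inj)
  let N := LinearMap.range (j ∘ₗ i)
  -- the map `X → C / A` is obtained from `B → C / A` by a choice of preimages
  have hker : LinearMap.ker p ≤ LinearMap.ker (N.mkQ ∘ₗ j) := fun b hb => by
    obtain ⟨a, rfl⟩ := (h₁.exact b).1 hb
    exact (Submodule.Quotient.mk_eq_zero N).2 ⟨a, rfl⟩
  let s : X →ₗ[S] C ⧸ N := (LinearMap.ker p).liftQ (N.mkQ ∘ₗ j) hker ∘ₗ
    (p.quotKerEquivOfSurjective h₁.surj).symm.toLinearMap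
  have hs : ∀ b, s (p b) = N.mkQ (j b) := fun b => by
    have : (p.quotKerEquivOfSurjective h₁.surj).symm (p b) = (LinearMap.ker p).mkQ b := by
      rw [LinearEquiv.symm_apply_eq]; rfl
    simp [s, this]
  have hN : N ≤ LinearMap.ker q := by
    rintro _ ⟨a, rfl⟩
    exact h₂.exact.apply_apply_eq_zero _
  refine ⟨_, _, s, N.liftQ q hN, hc, ?_, ?_, ?_⟩
  · refine (injective_iff_map_eq_zero _).2 fun x hx => ?_
    obtain ⟨b, rfl⟩ := h₁.surj x
    rw [hs] at hx
    obtain ⟨a, ha⟩ := (Submodule.Quotient.mk_eq_zero N).1 hx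
    rw [← h₂.inj ha]
    exact h₁.exact.apply_apply_eq_zero a
  · intro y
    obtain ⟨c, rfl⟩ := N.mkQ_surjective y
    constructor
    · intro hy
      obtain ⟨b, rfl⟩ := (h₂.exact c).1 hy
      exact ⟨p b, hs b⟩
    · rintro ⟨x, hx⟩
      obtain ⟨b, rfl⟩ := h₁.surj x
      rw [← hx, hs]
      exact h₂.exact.apply_apply_eq_zero b
  · intro y
    obtain ⟨c, rfl⟩ := h₂.surj y
    exact ⟨N.mkQ c, rfl⟩

/-! ### Contravariant self-equivalences -/

instance : (forget₂ (FGModuleCat.{u} S) (ModuleCat.{u} S)).PreservesZeroMorphisms :=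
  ⟨fun _ _ => rfl⟩

lemma injective_of_mono [IsNoetherianRing S] {A B : FGModuleCat.{u} S} (f : A ⟶ B) [Mono f] :
    Function.Injective f.hom.hom := by
  have : Mono ((forget₂ (FGModuleCat.{u} S) (ModuleCat.{u} S)).map f) := inferInstance
  exact (ModuleCat.mono_iff_injective _).1 this

lemma surjective_of_epi [IsNoetherianRing S] {A B : FGModuleCat.{u} S} (f : A ⟶ B) [Epi f] :
    Function.Surjective f.hom.hom := by
  have : Epi ((forget₂ (FGModuleCat.{u} S) (ModuleCat.{u} S)).map f) := inferInstance
  exact (ModuleCat.epi_iff_surjective _).1 this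

variable (D : (FGModuleCat.{u} S)ᵒᵖ ≌ FGModuleCat.{u} S)

instance : D.functor.Additive := by
  have := D.functor.preservesZeroMorphisms_of_isRightAdjoint
  exact Functor.additive_of_preserves_binary_products _

/-- The value of a contravariant self-equivalence on a module. -/
abbrev dualObj (M : FGModuleCat.{u} S) : FGModuleCat.{u} S := D.functor.obj (Opposite.op M)

/-- The value of a contravariant self-equivalence on a linear map. -/
noncomputable def dualMap {A B : FGModuleCat.{u} S} (f : A →ₗ[S] B) :
    dualObj D B →ₗ[S] dualObj D A :=
  (D.functor.map (FGModuleCat.ofHom f : A ⟶ B).op).hom.hom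

variable {A B C : FGModuleCat.{u} S}

@[simp] lemma dualMap_id : dualMap D (LinearMap.id : A →ₗ[S] A) = LinearMap.id := by
  have : (FGModuleCat.ofHom LinearMap.id : A ⟶ A) = 𝟙 A := rfl
  rw [dualMap, this, op_id, D.functor.map_id]
  rfl

lemma dualMap_comp (g : B →ₗ[S] C) (f : A →ₗ[S] B) :
    dualMap D (g ∘ₗ f) = dualMap D f ∘ₗ dualMap D g := by
  have : (FGModuleCat.ofHom (g ∘ₗ f) : A ⟶ C) =
    (FGModuleCat.ofHom f : A ⟶ B) ≫ (FGModuleCat.ofHom g : B ⟶ C) := rfl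
  rw [dualMap, this, op_comp, D.functor.map_comp]
  rfl

lemma dualMap_sub (f g : A →ₗ[S] B) : dualMap D (f - g) = dualMap D f - dualMap D g := by
  have : (FGModuleCat.ofHom (f - g) : A ⟶ B) =
    (FGModuleCat.ofHom f : A ⟶ B) - (FGModuleCat.ofHom g : A ⟶ B) := rfl
  rw [dualMap, this, op_sub, D.functor.map_sub]
  rfl

lemma dualMap_surjective (f : dualObj D B →ₗ[S] dualObj D A) :
    ∃ g : A →ₗ[S] B, dualMap D g = f := by
  obtain ⟨g, hg⟩ := D.functor.map_surjective (FGModuleCat.ofHom f : dualObj D B ⟶ dualObj D A)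
  exact ⟨g.unop.hom.hom, congrArg (fun φ => φ.hom.hom) hg⟩

lemma dualMap_injective {f g : A →ₗ[S] B} (h : dualMap D f = dualMap D g) : f = g := by
  have : (FGModuleCat.ofHom f : A ⟶ B).op = (FGModuleCat.ofHom g : A ⟶ B).op :=
    D.functor.map_injective (FGModuleCat.hom_ext h)
  exact congrArg (fun φ => φ.unop.hom.hom) this

/-- A contravariant self-equivalence is exact. -/
lemma IsSES.dual [IsNoetherianRing S] {f : A →ₗ[S] B} {g : B →ₗ[S] C} (h : IsSES f g) :
    IsSES (dualMap D g) (dualMap D f) := by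
  let F := forget₂ (FGModuleCat.{u} S) (ModuleCat.{u} S)
  let f' : A ⟶ B := FGModuleCat.ofHom f
  let g' : B ⟶ C := FGModuleCat.ofHom g
  let T : ShortComplex (FGModuleCat.{u} S) :=
    ShortComplex.mk f' g' (by ext x; exact h.exact.apply_apply_eq_zero x)
  have hmono : Mono f' := ConcreteCategory.mono_of_injective f' h.inj
  have hepi : Epi g' := ConcreteCategory.epi_of_surjective g' h.surj
  have hT : T.Exact := (ShortComplex.exact_map_iff_of_faithful T F).1
    ((ShortComplex.ShortExact.moduleCat_exact_iff_function_exact _).2 h.exact)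
  have hT' : ((T.op.map D.functor).map F).Exact :=
    (ShortComplex.exact_map_iff_of_faithful _ F).2 (hT.op.map D.functor)
  exact ⟨injective_of_mono (D.functor.map g'.op),
    (ShortComplex.ShortExact.moduleCat_exact_iff_function_exact _).1 hT',
    surjective_of_epi (D.functor.map f'.op)⟩

lemma dualMap_injective_of_surjective [IsNoetherianRing S]
    {g : B →ₗ[S] C} (hg : Function.Surjective g) :
    Function.Injective (dualMap D g) := ((IsSES.of_surjective hg).dual D).inj

lemma dualMap_surjective_of_injective [IsNoetherianRing S]
    {f : A →ₗ[S] B} (hf : Function.Injective f) :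
    Function.Surjective (dualMap D f) := ((IsSES.of_injective hf).dual D).surj

/-- Isomorphic modules have isomorphic duals. -/
noncomputable def dualEquiv (e : A ≃ₗ[S] B) : dualObj D B ≃ₗ[S] dualObj D A :=
  LinearEquiv.ofLinearMap (dualMap D e.toLinearMap) (dualMap D e.symm.toLinearMap)
    (by rw [← dualMap_comp]; simp) (by rw [← dualMap_comp]; simp)

lemma subsingleton_dualObj (h : Subsingleton A) : Subsingleton (dualObj D A) := by
  refine subsingleton_of_forall_eq 0 fun x => ?_
  have h0 : (LinearMap.id : A →ₗ[S] A) = LinearMap.id - LinearMap.id :=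
    LinearMap.ext fun _ => Subsingleton.elim _ _
  have := dualMap_sub D (LinearMap.id : A →ₗ[S] A) LinearMap.id
  rw [← h0, dualMap_id, sub_self] at this
  exact LinearMap.congr_fun this x

/-- The inverse of a contravariant self-equivalence, as a contravariant self-equivalence. -/
def dualInverse : (FGModuleCat.{u} S)ᵒᵖ ≌ FGModuleCat.{u} S := D.symm.op.trans (opOpEquivalence _)

lemma nonempty_dual_dualInverse (M : FGModuleCat.{u} S) :
    Nonempty (dualObj D (dualObj (dualInverse D) M) ≃ₗ[S] M) :=
  ⟨FGModuleCat.isoToLinearEquiv (D.counitIso.app M)⟩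

lemma nonempty_dualInverse_dual (M : FGModuleCat.{u} S) :
    Nonempty (dualObj (dualInverse D) (dualObj D M) ≃ₗ[S] M) :=
  ⟨FGModuleCat.isoToLinearEquiv (D.unitIso.app (Opposite.op M)).unop⟩

/-- A duality reverses extensions: `Ext¹(X, Z)` vanishes when `Ext¹(Z°, X°)` does. -/
lemma extVanish_one_of_dual [IsNoetherianRing S] {X Z : FGModuleCat.{u} S}
    (h : ExtVanish (dualObj D Z) (dualObj D X) 1) : ExtVanish X Z 1 := by
  obtain ⟨K, P, f, g, hP, hfg⟩ := exists_projective_presentation X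
  refine hfg.ext_one_of_extend extVanish_of_projective fun φ => ?_
  obtain ⟨E, j, q, ψ, hjq, hψ, -⟩ := hfg.exists_pushout φ
  obtain ⟨s, hs⟩ := (hjq.dual D).exists_lift h LinearMap.id
  obtain ⟨r, rfl⟩ := dualMap_surjective D s
  have hr : r ∘ₗ j = LinearMap.id := dualMap_injective D (by rw [dualMap_comp, hs, dualMap_id])
  exact ⟨r ∘ₗ ψ, by rw [LinearMap.comp_assoc, hψ, ← LinearMap.comp_assoc, hr, LinearMap.id_comp]⟩

end Duality

/-! ### Filtrations -/

section Filtration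

variable {S : Type u} [Ring S] {Λ : Type*} {X : Λ → FGModuleCat.{u} S}
  {M : Type u} [AddCommGroup M] [Module S M] {n : ℕ} {ν : Fin n → Λ}

/-- A nonzero map into the `m`-th step of a filtration induces a nonzero map into one of the
sections below `m`. -/
lemma exists_section_map_ne_zero {F : Fin (n + 1) → Submodule S M} (h0 : F 0 = ⊥)
    (hF : ∀ t : Fin n,
      Nonempty ((F t.succ ⧸ (F t.castSucc).submoduleOf (F t.succ)) ≃ₗ[S] X (ν t)))
    {A : Type*} [AddCommGroup A] [Module S A] {f : A →ₗ[S] M} (hf : f ≠ 0) (m : Fin (n + 1)) :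
    (∀ a, f a ∈ F m) → ∃ t : Fin n, t.castSucc < m ∧ ∃ g : A →ₗ[S] X (ν t), g ≠ 0 := by
  induction m using Fin.induction with
  | zero =>
    intro hm
    rw [h0] at hm
    exact absurd (LinearMap.ext fun a => (Submodule.mem_bot S).1 (hm a)) hf
  | succ t ih =>
    intro hm
    obtain ⟨e⟩ := hF t
    let g : A →ₗ[S] X (ν t) := e.toLinearMap ∘ₗ Submodule.mkQ _ ∘ₗ f.codRestrict (F t.succ) hm
    by_cases hg : g = 0
    · obtain ⟨s, hs, hs'⟩ := ih fun a => by
        have h1 : e (Submodule.Quotient.mk (f.codRestrict (F t.succ) hm a)) = 0 :=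
          LinearMap.congr_fun hg a
        rw [e.map_eq_zero_iff] at h1
        have h2 := (Submodule.Quotient.mk_eq_zero _).1 h1
        exact h2
      exact ⟨s, hs.trans t.castSucc_lt_succ, hs'⟩
    · exact ⟨t, t.castSucc_lt_succ, g, hg⟩

lemma HasFiltration.exists_map_ne_zero (h : HasFiltration X M ν) {A : Type*} [AddCommGroup A]
    [Module S A] {f : A →ₗ[S] M} (hf : f ≠ 0) : ∃ t, ∃ g : A →ₗ[S] X (ν t), g ≠ 0 := by
  obtain ⟨F, -, h0, h1, hF⟩ := h
  obtain ⟨t, -, ht⟩ := exists_section_map_ne_zero h0 hF hf (Fin.last n) fun a => by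
    rw [h1]; trivial
  exact ⟨t, ht⟩

/-- The top section of a filtration is a quotient of the filtered module. -/
lemma exists_top_section {n : ℕ} {ν : Fin (n + 1) → Λ} {F : Fin (n + 2) → Submodule S M}
    (h1 : F (Fin.last (n + 1)) = ⊤)
    (hF : ∀ t : Fin (n + 1),
      Nonempty ((F t.succ ⧸ (F t.castSucc).submoduleOf (F t.succ)) ≃ₗ[S] X (ν t))) :
    ∃ g : M →ₗ[S] X (ν (Fin.last n)),
      Function.Surjective g ∧ LinearMap.ker g = F (Fin.last n).castSucc := by
  obtain ⟨e⟩ := hF (Fin.last n)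
  have hmem : ∀ x, x ∈ F (Fin.last n).succ := fun x => by
    rw [Fin.succ_last, h1]; trivial
  let i : M →ₗ[S] F (Fin.last n).succ := LinearMap.id.codRestrict _ hmem
  refine ⟨e.toLinearMap ∘ₗ Submodule.mkQ _ ∘ₗ i, ?_, ?_⟩
  · refine e.surjective.comp ((Submodule.mkQ_surjective _).comp fun x => ⟨x, rfl⟩)
  · ext x
    rw [LinearMap.mem_ker]
    change e (Submodule.Quotient.mk (i x)) = 0 ↔ _
    rw [e.map_eq_zero_iff, Submodule.Quotient.mk_eq_zero]
    rfl

end Filtration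

namespace SimpleLabelling

variable {S : Type u} [Ring S] {Λ : Type*} (E : SimpleLabelling S Λ)

/-! ### Composition factors -/

/-- `L j` is a composition factor of `M`. This is expressed by the existence of a nonzero map from
the projective cover `P j` to `M`. -/
def Occ (j : Λ) (M : FGModuleCat.{u} S) : Prop := ∃ f : E.P j →ₗ[S] M, f ≠ 0

variable {E} {i j : Λ} {A B C M : FGModuleCat.{u} S}

instance (i : Λ) : IsSimpleModule S (E.L i) := E.simple i

instance (i : Λ) : Module.Projective S (E.P i) := (E.isProjectiveCover i).projective

lemma isCoatom_ker {N : Type*} [AddCommGroup N] [Module S N] {L : Type*} [AddCommGroup L]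
    [Module S L] [IsSimpleModule S L] {g : N →ₗ[S] L} (hg : Function.Surjective g) :
    IsCoatom (LinearMap.ker g) :=
  isSimpleModule_iff_isCoatom.1 (IsSimpleModule.congr (g.quotKerEquivOfSurjective hg))

/-- The kernel of the projective cover is the largest proper submodule. -/
lemma le_ker_cov {N : Submodule S (E.P i)} (hN : N ≠ ⊤) : N ≤ LinearMap.ker (E.cov i) := by
  by_contra h
  refine hN ((E.isProjectiveCover i).superfluous N ?_)
  rw [sup_comm]
  exact (isCoatom_ker (E.isProjectiveCover i).surjective).2 _ (left_lt_sup.2 h)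

lemma cov_ne_zero : E.cov i ≠ 0 := fun h => by
  have := IsSimpleModule.nontrivial S (E.L i)
  obtain ⟨x, hx⟩ := exists_ne (0 : E.L i)
  obtain ⟨y, rfl⟩ := (E.isProjectiveCover i).surjective x
  exact hx (by rw [h]; rfl)

lemma eq_of_occ_simple (h : E.Occ j (E.L i)) : j = i := by
  obtain ⟨f, hf⟩ := h
  have hs := LinearMap.surjective_of_ne_zero hf
  have h1 : LinearMap.ker f = LinearMap.ker (E.cov j) :=
    ((isCoatom_ker hs).le_iff_eq (isCoatom_ker (E.isProjectiveCover j).surjective).1).1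
      (le_ker_cov (isCoatom_ker hs).1) |>.symm
  have hc := (E.isProjectiveCover j).surjective
  exact E.eq_of_iso _ _ ⟨(((E.cov j).quotKerEquivOfSurjective hc).symm ≪≫ₗ
    Submodule.quotEquivOfEq _ _ h1.symm) ≪≫ₗ f.quotKerEquivOfSurjective hs⟩

lemma Occ.of_injective (h : E.Occ j A) {f : A →ₗ[S] B} (hf : Function.Injective f) :
    E.Occ j B := by
  obtain ⟨g, hg⟩ := h
  refine ⟨f ∘ₗ g, fun h0 => hg (LinearMap.ext fun x => hf ?_)⟩
  rw [LinearMap.zero_apply, map_zero]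
  exact LinearMap.congr_fun h0 x

lemma Occ.of_surjective (h : E.Occ j B) {f : A →ₗ[S] B} (hf : Function.Surjective f) :
    E.Occ j A := by
  obtain ⟨g, hg⟩ := h
  obtain ⟨g', rfl⟩ := Module.projective_lifting_property f g hf
  exact ⟨g', fun h0 => hg (by rw [h0, LinearMap.comp_zero])⟩

lemma Occ.of_isSES (h : E.Occ j B) {f : A →ₗ[S] B} {g : B →ₗ[S] C} (hfg : IsSES f g) :
    E.Occ j A ∨ E.Occ j C := by
  obtain ⟨φ, hφ⟩ := h
  by_cases h0 : g ∘ₗ φ = 0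
  · left
    obtain ⟨ψ, rfl⟩ := hfg.exists_factor h0
    exact ⟨ψ, fun h1 => hφ (by rw [h1, LinearMap.comp_zero])⟩
  · exact Or.inr ⟨_, h0⟩

lemma exists_simple_submodule [IsArtinianRing S] (E : SimpleLabelling S Λ) (h : Nontrivial M) :
    ∃ (j : Λ) (f : E.L j →ₗ[S] M), Function.Injective f := by
  obtain ⟨N, hN⟩ := IsAtomic.exists_atom (Submodule S M)
  obtain ⟨j, ⟨e⟩⟩ := E.exists_iso N (isSimpleModule_iff_isAtom.2 hN)
  exact ⟨j, N.subtype ∘ₗ e.symm.toLinearMap, N.subtype_injective.comp e.symm.injective⟩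

/-- Every composition factor is a quotient of a submodule. -/
lemma Occ.exists_subquotient [IsNoetherianRing S] (h : E.Occ j M) :
    ∃ (B : FGModuleCat.{u} S) (f : B →ₗ[S] M) (g : B →ₗ[S] E.L j),
      Function.Injective f ∧ Function.Surjective g := by
  obtain ⟨φ, hφ⟩ := h
  have hk : LinearMap.ker φ ≤ LinearMap.ker (E.cov j) :=
    le_ker_cov fun h => hφ (LinearMap.ker_eq_top.1 h)
  refine ⟨FGModuleCat.of S (LinearMap.range φ), (LinearMap.range φ).subtype,
    (LinearMap.ker φ).liftQ (E.cov j) hk ∘ₗ φ.quotKerEquivRange.symm.toLinearMap,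
    Submodule.subtype_injective _, ?_⟩
  intro x
  obtain ⟨y, rfl⟩ := (E.isProjectiveCover j).surjective x
  refine ⟨⟨φ y, LinearMap.mem_range_self φ y⟩, ?_⟩
  rw [LinearMap.comp_apply, LinearEquiv.coe_coe,
    φ.quotKerEquivRange_symm_apply_image y (LinearMap.mem_range_self φ y)]
  rfl

/-- A simple-preserving duality preserves composition factors. -/
lemma Occ.dual [IsNoetherianRing S] {D : (FGModuleCat.{u} S)ᵒᵖ ≌ FGModuleCat.{u} S}
    (hD : ∀ i, Nonempty (dualObj D (E.L i) ≃ₗ[S] E.L i)) (h : E.Occ j M) :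
    E.Occ j (dualObj D M) := by
  obtain ⟨B, f, g, hf, hg⟩ := h.exists_subquotient
  obtain ⟨e⟩ := hD j
  have h1 : E.Occ j (dualObj D (E.L j)) :=
    Occ.of_injective ⟨_, cov_ne_zero⟩ e.symm.injective (f := e.symm.toLinearMap)
  exact (h1.of_injective (dualMap_injective_of_surjective D hg)).of_surjective
    (dualMap_surjective_of_injective D hf)

end SimpleLabelling

namespace SimpleLabelling

variable {S : Type u} [Ring S] {Λ : Type*} [PartialOrder Λ] {E : SimpleLabelling S Λ}
  {i j : Λ} {A B C M X Y : FGModuleCat.{u} S} {n : ℕ}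

/-! ### Standard modules -/

lemma occ_le_of_occ_Δ (h : E.Occ j (E.Δ i)) : j ≤ i := by
  obtain ⟨f, hf⟩ := h
  obtain ⟨x, hx⟩ : ∃ x, f x ≠ 0 := by
    by_contra! h0
    exact hf (LinearMap.ext h0)
  obtain ⟨y, hy⟩ := Submodule.mkQ_surjective _ (f x)
  have hy' : y ∉ sInf {N : Submodule S (E.P i) | E.FactorsLE i (E.P i ⧸ N)} := fun h0 => by
    rw [← hy] at hx
    exact hx ((Submodule.Quotient.mk_eq_zero _).2 h0)
  rw [Submodule.mem_sInf] at hy'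
  push Not at hy'
  obtain ⟨N, hN, hyN⟩ := hy'
  let g : E.Δ i →ₗ[S] E.P i ⧸ N := Submodule.factor (sInf_le hN)
  have hg : g ∘ₗ f ≠ 0 := fun h0 => by
    have h1 : g (f x) = 0 := LinearMap.congr_fun h0 x
    rw [← hy] at h1
    exact hyN ((Submodule.Quotient.mk_eq_zero N).1 h1)
  obtain ⟨m, ν, hν, hle⟩ := hN
  obtain ⟨t, ψ, hψ⟩ := hν.exists_map_ne_zero hg
  rw [eq_of_occ_simple (E := E) ⟨ψ, hψ⟩]
  exact hle t

lemma IsQuasiHereditary.nontrivial_Δ (hE : E.IsQuasiHereditary) (i : Λ) : Nontrivial (E.Δ i) := by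
  obtain ⟨n, ν, ⟨F, -, -, -, hF⟩, t, -⟩ := hE.simple_once i
  obtain ⟨e⟩ := hF t
  have := IsSimpleModule.nontrivial S (E.L (ν t))
  have h1 := e.toEquiv.nontrivial
  have h2 : Nontrivial (F t.succ) :=
    (Submodule.mkQ_surjective ((F t.castSucc).submoduleOf (F t.succ))).nontrivial
  exact (F t.succ).subtype_injective.nontrivial

/-- `Δ(i)` has a largest proper submodule, with quotient `L i`. -/
lemma IsQuasiHereditary.exists_top_Δ (hE : E.IsQuasiHereditary) (i : Λ) :
    ∃ π : E.Δ i →ₗ[S] E.L i, Function.Surjective π ∧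
      ∀ U : Submodule S (E.Δ i), U ≠ ⊤ → U ≤ LinearMap.ker π := by
  set N := sInf {N : Submodule S (E.P i) | E.FactorsLE i (E.P i ⧸ N)} with hNdef
  have hnt := hE.nontrivial_Δ i
  have hN : N ≤ LinearMap.ker (E.cov i) := le_ker_cov fun h => by
    have : Subsingleton (E.P i ⧸ N) := Submodule.Quotient.subsingleton_iff.2 h
    exact not_subsingleton (E.Δ i) this
  refine ⟨N.liftQ (E.cov i) hN, fun x => ?_, fun U hU y hy => ?_⟩
  · obtain ⟨y, rfl⟩ := (E.isProjectiveCover i).surjective x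
    exact ⟨N.mkQ y, rfl⟩
  · obtain ⟨x, rfl⟩ := N.mkQ_surjective y
    have h1 : U.comap N.mkQ ≠ ⊤ := fun h0 => hU <| by
      rw [← Submodule.map_comap_eq_of_surjective N.mkQ_surjective U, h0, Submodule.map_top,
        Submodule.range_mkQ]
      rfl
    exact le_ker_cov h1 (show x ∈ U.comap N.mkQ from hy)

lemma occ_of_Δ_map_ne_zero {f : E.Δ j →ₗ[S] M} (hf : f ≠ 0) : E.Occ j M := by
  refine ⟨f ∘ₗ Submodule.mkQ _, fun h => hf (LinearMap.ext fun x => ?_)⟩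
  obtain ⟨y, rfl⟩ := Submodule.mkQ_surjective _ x
  exact LinearMap.congr_fun h y

/-- All composition factors of the radical of `Δ(i)` are `L j` with `j < i`. -/
lemma IsQuasiHereditary.lt_of_occ_radical [IsNoetherianRing S] (hE : E.IsQuasiHereditary)
    {π : E.Δ i →ₗ[S] E.L i} (hπ : Function.Surjective π)
    (hmax : ∀ U : Submodule S (E.Δ i), U ≠ ⊤ → U ≤ LinearMap.ker π)
    (h : E.Occ j (FGModuleCat.of S (LinearMap.ker π))) : j < i := by
  have hle := occ_le_of_occ_Δ (h.of_injective (B := E.Δ i) (LinearMap.ker π).subtype_injective)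
  refine lt_of_le_of_ne hle fun hji => ?_
  subst hji
  obtain ⟨n, ν, ⟨F, -, h0, h1, hF⟩, t, ht, huniq⟩ := hE.simple_once j
  obtain ⟨n, rfl⟩ : ∃ m, n = m + 1 := ⟨n - 1, by have := t.2; lia⟩
  obtain ⟨g, hg, hker⟩ := exists_top_section h1 hF
  have hco := isCoatom_ker hg
  have hνl : j = ν (Fin.last n) := by
    refine eq_of_occ_simple (E := E) (occ_of_Δ_map_ne_zero (f := g) fun h => hco.1 ?_)
    rw [h, LinearMap.ker_zero]
  have hker' : LinearMap.ker π = F (Fin.last n).castSucc := by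
    rw [← hker]
    exact (hco.le_iff_eq (isCoatom_ker hπ).1).1 (hmax _ hco.1)
  obtain ⟨f, hf⟩ := h
  have hf' : (LinearMap.ker π).subtype ∘ₗ f ≠ 0 := fun h => hf <| LinearMap.ext fun x =>
    Subtype.ext (LinearMap.congr_fun h x)
  obtain ⟨s, hs, ψ, hψ⟩ := exists_section_map_ne_zero h0 hF hf' (Fin.last n).castSucc fun a => by
    rw [← hker']; exact (f a).2
  have h2 : s = t := huniq s (eq_of_occ_simple (E := E) ⟨ψ, hψ⟩).symm
  have h3 : Fin.last n = t := huniq _ hνl.symm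
  rw [h2, ← h3] at hs
  exact lt_irrefl _ hs

/-! ### Modules with a filtration by standard modules -/

variable (E) in
/-- The class of modules with a finite filtration whose sections are standard modules `Δ(i)` with
`i` satisfying `Q`, defined as the closure of these standard modules under extensions. -/
inductive Filt (Q : Λ → Prop) : FGModuleCat.{u} S → Prop
  | zero (M : FGModuleCat.{u} S) : Subsingleton M → Filt Q M
  | std (i : Λ) : Q i → Filt Q (E.Δ i)
  | ext {A B C : FGModuleCat.{u} S} (f : A →ₗ[S] B) (g : B →ₗ[S] C) :
      IsSES f g → Filt Q A → Filt Q C → Filt Q B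

lemma Filt.of_equiv {Q : Λ → Prop} (h : E.Filt Q A) (e : A ≃ₗ[S] B) : E.Filt Q B :=
  Filt.ext _ _ (IsSES.of_equiv_zero e) h (Filt.zero _ (inferInstanceAs (Subsingleton PUnit)))

lemma Filt.mono {Q R : Λ → Prop} (h : E.Filt Q M) (hQR : ∀ i, Q i → R i) : E.Filt R M := by
  induction h with
  | zero M hM => exact Filt.zero M hM
  | std i hi => exact Filt.std i (hQR i hi)
  | ext f g hfg _ _ h1 h2 => exact Filt.ext f g hfg h1 h2

/-- The steps of a filtration by standard modules. -/
lemma filt_of_filtration [IsNoetherianRing S] {Q : Λ → Prop} {n : ℕ} {ν : Fin n → Λ}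
    {F : Fin (n + 1) → Submodule S M} (hmono : Monotone F) (h0 : F 0 = ⊥)
    (hF : ∀ t : Fin n,
      Nonempty ((F t.succ ⧸ (F t.castSucc).submoduleOf (F t.succ)) ≃ₗ[S] E.Δ (ν t)))
    (m : Fin (n + 1)) :
    (∀ t : Fin n, t.castSucc < m → Q (ν t)) → E.Filt Q (FGModuleCat.of S (F m)) := by
  induction m using Fin.induction with
  | zero =>
    intro _
    rw [h0]
    exact Filt.zero _ (inferInstanceAs (Subsingleton (⊥ : Submodule S M)))
  | succ t ih =>
    intro hQ
    obtain ⟨e⟩ := hF t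
    have hle : F t.castSucc ≤ F t.succ := hmono t.castSucc_lt_succ.le
    refine Filt.ext (A := FGModuleCat.of S (F t.castSucc)) (B := FGModuleCat.of S (F t.succ))
      (Submodule.inclusion hle) (e.toLinearMap ∘ₗ Submodule.mkQ _) ⟨?_, ?_, ?_⟩
      (ih fun s hs => hQ s (hs.trans t.castSucc_lt_succ)) (Filt.std _ (hQ t t.castSucc_lt_succ))
    · exact Submodule.inclusion_injective hle
    · intro x
      change e (Submodule.Quotient.mk x) = 0 ↔ _
      rw [e.map_eq_zero_iff, Submodule.Quotient.mk_eq_zero]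
      constructor
      · intro hx
        exact ⟨⟨x.1, hx⟩, rfl⟩
      · rintro ⟨y, rfl⟩
        exact y.2
    · exact e.surjective.comp (Submodule.mkQ_surjective _)

/-- The kernel of `P i → Δ(i)` is filtered by `Δ(j)` with `j > i`. -/
lemma IsQuasiHereditary.exists_presentation_Δ [IsNoetherianRing S] (hE : E.IsQuasiHereditary)
    (i : Λ) : ∃ (K : FGModuleCat.{u} S) (f : K →ₗ[S] E.P i) (g : E.P i →ₗ[S] E.Δ i),
      IsSES f g ∧ E.Filt (i < ·) K := by
  obtain ⟨n, ν, ⟨F, hmono, h0, h1, hF⟩, ⟨t, ht, huniq⟩, hle⟩ := hE.standard_filtration i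
  obtain ⟨n, rfl⟩ : ∃ m, n = m + 1 := ⟨n - 1, by have := t.2; lia⟩
  obtain ⟨g, hg, hker⟩ := exists_top_section h1 hF
  obtain ⟨π, hπ, -⟩ := hE.exists_top_Δ (ν (Fin.last n))
  have hνl : i = ν (Fin.last n) := by
    refine eq_of_occ_simple (E := E) ⟨π ∘ₗ g, fun h => ?_⟩
    have := IsSimpleModule.nontrivial S (E.L (ν (Fin.last n)))
    obtain ⟨x, hx⟩ := exists_ne (0 : E.L (ν (Fin.last n)))
    obtain ⟨y, rfl⟩ := (hπ.comp hg) x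
    exact hx (LinearMap.congr_fun h y)
  have hK : E.Filt (i < ·) (FGModuleCat.of S (F (Fin.last n).castSucc)) :=
    filt_of_filtration hmono h0 hF _ fun s hs => lt_of_le_of_ne (hle s) fun h => by
      have h2 : s = Fin.last n := (huniq s h.symm).trans (huniq _ hνl.symm).symm
      rw [h2] at hs
      exact lt_irrefl _ hs
  rw [← hker] at hK
  have key : ∀ m, i = m → ∀ g : E.P i →ₗ[S] E.Δ m, Function.Surjective g →
      E.Filt (i < ·) (FGModuleCat.of S (LinearMap.ker g)) →
      ∃ (K : FGModuleCat.{u} S) (f : K →ₗ[S] E.P i) (g : E.P i →ₗ[S] E.Δ i),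
        IsSES f g ∧ E.Filt (i < ·) K := by
    rintro _ rfl g hg hK
    exact ⟨_, _, g, IsSES.of_surjective hg, hK⟩
  exact key _ hνl g hg hK

end SimpleLabelling

namespace SimpleLabelling

variable {S : Type u} [Ring S] {Λ : Type*} [PartialOrder Λ] {E : SimpleLabelling S Λ}
  {i j : Λ} {A B C M X Y : FGModuleCat.{u} S} {n : ℕ}

/-! ### Vanishing of extensions -/

lemma Filt.extVanish {Q : Λ → Prop} (h : E.Filt Q X)
    (hY : ∀ i, Q i → ExtVanish (E.Δ i) Y n) : ExtVanish X Y n := by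
  induction h with
  | zero M hM => exact extVanish_of_subsingleton_left hM
  | std i hi => exact hY i hi
  | ext f g hfg _ _ h1 h2 => exact hfg.ext_contravariant₂ h1 h2

lemma Filt.extVanish_right {Q : Λ → Prop} (h : E.Filt Q Y)
    (hX : ∀ i, Q i → ExtVanish X (E.Δ i) n) : ExtVanish X Y n := by
  induction h with
  | zero M hM =>
    exact extVanish_of_subsingleton_right hM
  | std i hi => exact hX i hi
  | ext f g hfg _ _ h1 h2 => exact hfg.ext_covariant₂ h1 h2

/-- If `Ext^{n+1}(Δ(i), M) ≠ 0`, then `M` has a composition factor `L j` with `j > i`. -/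
lemma IsQuasiHereditary.extVanish_Δ [IsNoetherianRing S] (hE : E.IsQuasiHereditary) (n : ℕ) :
    ∀ i, (∀ j, i < j → ¬ E.Occ j M) → ExtVanish (E.Δ i) M (n + 1) := by
  induction n with
  | zero =>
    intro i h
    obtain ⟨K, f, g, hfg, hK⟩ := hE.exists_presentation_Δ i
    refine hfg.ext_contravariant₃ (hK.extVanish fun j hj => ?_) extVanish_of_projective
    exact extVanish_zero_iff.2 fun φ => by_contra fun hφ => h j hj (occ_of_Δ_map_ne_zero hφ)
  | succ n ih =>
    intro i h
    obtain ⟨K, f, g, hfg, hK⟩ := hE.exists_presentation_Δ i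
    exact hfg.ext_contravariant₃
      (hK.extVanish fun j hj => ih j fun l hl => h l (lt_trans hj hl)) extVanish_of_projective

lemma IsQuasiHereditary.extVanish_Δ_Δ [IsNoetherianRing S] (hE : E.IsQuasiHereditary)
    (h : ¬ i < j) (n : ℕ) : ExtVanish (E.Δ i) (E.Δ j) (n + 1) :=
  hE.extVanish_Δ n i fun _ hl ho => h (lt_of_lt_of_le hl (occ_le_of_occ_Δ ho))

variable (E) in
/-- The class of modules `Y` with `Ext^n(Δ(i), Y) = 0` for all `i` and all `n > 0`, that is, the
modules with a filtration by costandard modules. -/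
def Good (Y : FGModuleCat.{u} S) : Prop := ∀ (n : ℕ) (i : Λ), ExtVanish (E.Δ i) Y (n + 1)

/-- Vanishing of `Ext¹` from the standard modules suffices. -/
lemma IsQuasiHereditary.good_of_ext_one [IsNoetherianRing S] (hE : E.IsQuasiHereditary)
    (h : ∀ i, ExtVanish (E.Δ i) Y 1) : E.Good Y := by
  intro n
  induction n with
  | zero => exact h
  | succ n ih =>
    intro i
    obtain ⟨K, f, g, hfg, hK⟩ := hE.exists_presentation_Δ i
    exact hfg.ext_contravariant₃ (hK.extVanish fun j _ => ih j) extVanish_of_projective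

lemma Good.extVanish {Q : Λ → Prop} (hY : E.Good Y) (hX : E.Filt Q X) (n : ℕ) :
    ExtVanish X Y (n + 1) := hX.extVanish fun i _ => hY n i

lemma Good.of_equiv (h : E.Good A) (e : A ≃ₗ[S] B) : E.Good B := fun n i =>
  extVanish_of_equiv_right e (h n i)

/-! ### Approximation by modules with costandard filtrations -/

section Approximation

omit [PartialOrder Λ] in
/-- The group of homomorphisms between finitely generated modules is finitely generated over the
ground field. -/
lemma exists_finite_generation (k : Type*) [Field k] [Algebra k S] [FiniteDimensional k S]
    (A B : FGModuleCat.{u} S) : ∃ (n : ℕ) (φ : Fin n → (A →ₗ[S] B)), ∀ f : A →ₗ[S] B,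
      ∃ c : Fin n → k, ∀ a, f a = ∑ t, algebraMap k S (c t) • φ t a := by
  let _ : Module k A := Module.compHom A (algebraMap k S)
  let _ : Module k B := Module.compHom B (algebraMap k S)
  have hA : IsScalarTower k S A := ⟨fun c s a => by
    rw [Algebra.smul_def, mul_smul]; rfl⟩
  have hB : IsScalarTower k S B := ⟨fun c s a => by
    rw [Algebra.smul_def, mul_smul]; rfl⟩
  have hc : SMulCommClass S k B := ⟨fun s c b => by
    change s • algebraMap k S c • b = algebraMap k S c • s • b
    rw [← mul_smul, ← mul_smul, Algebra.commutes]⟩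
  have fA : Module.Finite k A := Module.Finite.trans S A
  have fB : Module.Finite k B := Module.Finite.trans S B
  have : Module.Finite k (A →ₗ[S] B) := Module.Finite.of_injective
    (LinearMap.restrictScalarsₗ k S A B k) (LinearMap.restrictScalars_injective k)
  obtain ⟨n, φ, hφ⟩ := Module.Finite.exists_fin (R := k) (M := A →ₗ[S] B)
  refine ⟨n, φ, fun f => ?_⟩
  obtain ⟨c, hc⟩ := (Submodule.mem_span_range_iff_exists_fun k).1
    (show f ∈ Submodule.span k (Set.range φ) by rw [hφ]; trivial)
  refine ⟨c, fun a => ?_⟩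
  rw [← hc, LinearMap.sum_apply]
  rfl

/-- A sequence of pushouts which makes finitely many maps extendable. -/
lemma exists_extension_of_maps {K P : FGModuleCat.{u} S} {f : K →ₗ[S] P} {g : P →ₗ[S] E.Δ i}
    (h : IsSES f g) (m : ℕ) : ∀ (M : FGModuleCat.{u} S) (φ : Fin m → (K →ₗ[S] M)),
      ∃ (M' X : FGModuleCat.{u} S) (j : M →ₗ[S] M') (q : M' →ₗ[S] X),
        IsSES j q ∧ E.Filt (· = i) X ∧ ∀ t, ∃ ψ : P →ₗ[S] M', ψ ∘ₗ f = j ∘ₗ φ t := by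
  induction m with
  | zero =>
    intro M φ
    exact ⟨M, _, _, _, IsSES.of_equiv_zero (LinearEquiv.refl S M),
      Filt.zero _ (inferInstanceAs (Subsingleton PUnit)), fun t => t.elim0⟩
  | succ m ih =>
    intro M φ
    obtain ⟨M₁, j₁, q₁, ψ₁, h₁, hψ₁, -⟩ := h.exists_pushout (φ 0)
    obtain ⟨M₂, X₂, j₂, q₂, h₂, hX₂, hψ₂⟩ := ih M₁ fun t => j₁ ∘ₗ φ t.succ
    obtain ⟨Z, r, s, t, hr, hst⟩ := h₁.exists_comp h₂
    refine ⟨M₂, Z, _, r, hr, Filt.ext s t hst (Filt.std i rfl) hX₂, fun t => ?_⟩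
    refine Fin.cases ⟨j₂ ∘ₗ ψ₁, ?_⟩ (fun t => ?_) t
    · rw [LinearMap.comp_assoc, hψ₁, LinearMap.comp_assoc]
    · obtain ⟨ψ, hψ⟩ := hψ₂ t
      exact ⟨ψ, by rw [hψ, LinearMap.comp_assoc]⟩

/-- An iterated extension of `M` by copies of `Δ(i)` that kills `Ext¹(Δ(i), -)`. -/
lemma IsQuasiHereditary.exists_universal_extension (k : Type*) [Field k] [Algebra k S]
    [FiniteDimensional k S] [IsNoetherianRing S] (hE : E.IsQuasiHereditary) (i : Λ)
    (M : FGModuleCat.{u} S) :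
    ∃ (M' X : FGModuleCat.{u} S) (j : M →ₗ[S] M') (q : M' →ₗ[S] X),
      IsSES j q ∧ E.Filt (· = i) X ∧ ExtVanish (E.Δ i) M' 1 := by
  obtain ⟨K, f, g, hfg, -⟩ := hE.exists_presentation_Δ i
  obtain ⟨n, φ, hφ⟩ := exists_finite_generation k K M
  obtain ⟨M', X, j, q, hjq, hX, hψ⟩ := exists_extension_of_maps hfg n M φ
  choose ψ hψ using hψ
  refine ⟨M', X, j, q, hjq, hX, hfg.ext_one_of_extend extVanish_of_projective fun θ => ?_⟩
  -- modulo a map that extends to `P i`, the map `θ` takes values in `M`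
  have hXi : ExtVanish (E.Δ i) X 1 :=
    hX.extVanish_right fun l hl => hE.extVanish_Δ_Δ (by rw [hl]; exact lt_irrefl i) 0
  obtain ⟨ρ, hρ⟩ := hfg.exists_extend hXi (q ∘ₗ θ)
  obtain ⟨ρ', hρ'⟩ := Module.projective_lifting_property q ρ hjq.surj
  obtain ⟨θ', hθ'⟩ := hjq.exists_factor (φ := θ - ρ' ∘ₗ f) (by
    rw [LinearMap.comp_sub, ← LinearMap.comp_assoc, hρ', hρ, sub_self])
  obtain ⟨c, hc⟩ := hφ θ'
  let ψ' : E.P i →ₗ[S] M' :=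
    { toFun := fun p => ∑ t, algebraMap k S (c t) • ψ t p
      map_add' := fun x y => by simp [Finset.sum_add_distrib]
      map_smul' := fun s x => by
        simp only [map_smul, RingHom.id_apply, Finset.smul_sum, ← mul_smul, Algebra.commutes] }
  have hψ' : ψ' ∘ₗ f = j ∘ₗ θ' := by
    ext x
    change ∑ t, algebraMap k S (c t) • ψ t (f x) = j (θ' x)
    rw [hc, map_sum]
    refine Finset.sum_congr rfl fun t _ => ?_
    rw [map_smul]
    exact congrArg _ (LinearMap.congr_fun (hψ t) x)
  exact ⟨ψ' + ρ', by rw [LinearMap.add_comp, hψ', hθ', sub_add_cancel]⟩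

/-- Every module `M` embeds into a module `Y` with a costandard filtration such that `Y / M` has a
standard filtration. -/
theorem IsQuasiHereditary.exists_approximation (k : Type*) [Field k] [Algebra k S]
    [FiniteDimensional k S] [IsNoetherianRing S] [Finite Λ] (hE : E.IsQuasiHereditary)
    (M : FGModuleCat.{u} S) :
    ∃ (Y X : FGModuleCat.{u} S) (f : M →ₗ[S] Y) (g : Y →ₗ[S] X),
      IsSES f g ∧ E.Good Y ∧ E.Filt (fun _ => True) X := by
  classical
  have := Fintype.ofFinite Λ
  -- the labels are treated one at a time, the minimal ones last
  have key : ∀ U : Finset Λ, ∃ (Y X : FGModuleCat.{u} S) (f : M →ₗ[S] Y) (g : Y →ₗ[S] X),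
      IsSES f g ∧ (∀ i ∈ U, ExtVanish (E.Δ i) Y 1) ∧ E.Filt (fun _ => True) X := by
    intro U
    induction U using Finset.strongInduction with
    | H U ih =>
      rcases U.eq_empty_or_nonempty with rfl | hU
      · exact ⟨M, _, _, _, IsSES.of_equiv_zero (LinearEquiv.refl S M), by simp,
          Filt.zero _ (inferInstanceAs (Subsingleton PUnit))⟩
      · obtain ⟨i, hi⟩ := U.exists_minimal hU
        obtain ⟨Y₀, X₀, f₀, g₀, h₀, hY₀, hX₀⟩ := ih (U.erase i) (Finset.erase_ssubset hi.1)
        obtain ⟨Y₁, X₁, f₁, g₁, h₁, hX₁, hY₁⟩ := hE.exists_universal_extension k i Y₀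
        obtain ⟨Z, r, s, t, hr, hst⟩ := h₀.exists_comp h₁
        refine ⟨Y₁, Z, _, r, hr, fun j hj => ?_,
          Filt.ext s t hst hX₀ (hX₁.mono fun _ _ => trivial)⟩
        by_cases hji : j = i
        · exact hji ▸ hY₁
        · refine h₁.ext_covariant₂ (hY₀ j (Finset.mem_erase.2 ⟨hji, hj⟩))
            (hX₁.extVanish_right fun l hl => hE.extVanish_Δ_Δ (fun hlt => ?_) 0)
          rw [hl] at hlt
          exact hi.not_lt hj hlt
  obtain ⟨Y, X, f, g, h, hY, hX⟩ := key Finset.univ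
  exact ⟨Y, X, f, g, h, hE.good_of_ext_one fun i => hY i (Finset.mem_univ i), hX⟩

end Approximation

end SimpleLabelling

section Length

variable {S : Type u} [Ring S] [IsArtinianRing S] {A B C : FGModuleCat.{u} S} {f : A →ₗ[S] B}
  {g : B →ₗ[S] C}

lemma IsSES.length_lt (h : IsSES f g) (hA : Nontrivial A) :
    Module.length S C < Module.length S B := by
  rw [Module.length_eq_add_of_exact f g h.inj h.surj h.exact]
  exact ENat.lt_add_left (Module.length_ne_top (R := S) (M := C))
    (Module.length_pos (R := S) (M := A))

end Length

namespace SimpleLabelling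

variable {S : Type u} [Ring S] {Λ : Type*} {E : SimpleLabelling S Λ}
  {i j : Λ} {A B C M N X Y : FGModuleCat.{u} S} {n : ℕ}

/-- Dévissage along a composition series of the first argument. -/
lemma extVanish_of_occ [IsArtinianRing S] (E : SimpleLabelling S Λ) (C : FGModuleCat.{u} S)
    (h : ∀ j, E.Occ j C → ExtVanish (E.L j) M n) : ExtVanish C M n := by
  induction hl : Module.length S C using WellFoundedLT.induction generalizing C with
  | ind l ih =>
    rcases subsingleton_or_nontrivial C with hC | hC
    · exact extVanish_of_subsingleton_left hC
    · obtain ⟨j, f, hf⟩ := E.exists_simple_submodule hC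
      have hs := IsSES.of_injective hf
      have hj : E.Occ j (E.L j) := ⟨_, cov_ne_zero⟩
      have := IsSimpleModule.nontrivial S (E.L j)
      exact hs.ext_contravariant₂ (h j (hj.of_injective hf))
        (ih _ (hl ▸ hs.length_lt this) _ (fun m hm => h m (hm.of_surjective hs.surj)) rfl)

/-- The image of a nonzero map contains a simple module, which is a composition factor of the
source. -/
lemma exists_occ_of_map_ne_zero [IsArtinianRing S] (E : SimpleLabelling S Λ) {φ : A →ₗ[S] M}
    (hφ : φ ≠ 0) : ∃ j, E.Occ j A ∧ ∃ f : E.L j →ₗ[S] M, Function.Injective f := by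
  have hn : Nontrivial (FGModuleCat.of S (LinearMap.range φ)) :=
    Submodule.nontrivial_iff_ne_bot.2 fun h => hφ (LinearMap.range_eq_bot.1 h)
  obtain ⟨j, f, hf⟩ := E.exists_simple_submodule hn
  have hj : E.Occ j (E.L j) := ⟨_, cov_ne_zero⟩
  refine ⟨j, (hj.of_injective hf).of_surjective (A := A) (f := φ.rangeRestrict)
    φ.surjective_rangeRestrict, (LinearMap.range φ).subtype ∘ₗ f, ?_⟩
  rw [LinearMap.coe_comp]
  exact (LinearMap.range φ).subtype_injective.comp hf

/-! ### Duality and costandard modules -/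

variable (E) in
/-- Two mutually inverse simple-preserving dualities. -/
structure IsDualityPair (D D' : (FGModuleCat.{u} S)ᵒᵖ ≌ FGModuleCat.{u} S) : Prop where
  simple : ∀ i, Nonempty (dualObj D (E.L i) ≃ₗ[S] E.L i)
  simple' : ∀ i, Nonempty (dualObj D' (E.L i) ≃ₗ[S] E.L i)
  equiv : ∀ M, Nonempty (dualObj D (dualObj D' M) ≃ₗ[S] M)
  equiv' : ∀ M, Nonempty (dualObj D' (dualObj D M) ≃ₗ[S] M)

variable {D D' : (FGModuleCat.{u} S)ᵒᵖ ≌ FGModuleCat.{u} S}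

lemma IsDualityPair.symm (h : E.IsDualityPair D D') : E.IsDualityPair D' D :=
  ⟨h.simple', h.simple, h.equiv', h.equiv⟩

lemma isDualityPair_dualInverse (hD : ∀ i, Nonempty (dualObj D (E.L i) ≃ₗ[S] E.L i)) :
    E.IsDualityPair D (dualInverse D) where
  simple := hD
  simple' i := by
    obtain ⟨e⟩ := hD i
    obtain ⟨e'⟩ := nonempty_dualInverse_dual D (E.L i)
    exact ⟨(dualEquiv (dualInverse D) e).trans e'⟩
  equiv := nonempty_dual_dualInverse D
  equiv' := nonempty_dualInverse_dual D

/-- Symmetry of the vanishing of `Ext¹(X, Y°)` in `X` and `Y`; the two duals are taken with respect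
to mutually inverse dualities. -/
lemma IsDualityPair.extVanish_one [IsNoetherianRing S] (hp : E.IsDualityPair D D')
    (h : ExtVanish Y (dualObj D X) 1) : ExtVanish X (dualObj D' Y) 1 := by
  obtain ⟨e⟩ := hp.equiv Y
  exact extVanish_one_of_dual D (extVanish_of_equiv_left e.symm h)

lemma IsDualityPair.occ_of_occ_dual [IsNoetherianRing S] (hp : E.IsDualityPair D D')
    (h : E.Occ j (dualObj D' M)) : E.Occ j M := by
  obtain ⟨e⟩ := hp.equiv M
  exact (h.dual hp.simple).of_injective (f := e.toLinearMap) e.injective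

section

variable [PartialOrder Λ]

/-- Standard modules have no extensions by costandard modules. -/
lemma IsDualityPair.good_dual_Δ [IsNoetherianRing S] (hp : E.IsDualityPair D D')
    (hE : E.IsQuasiHereditary) (j : Λ) : E.Good (dualObj D' (E.Δ j)) := by
  refine hE.good_of_ext_one fun i => ?_
  by_cases hij : i < j
  · refine hp.extVanish_one (hE.extVanish_Δ 0 j fun l hl ho => ?_)
    exact lt_asymm hij (lt_of_lt_of_le hl (occ_le_of_occ_Δ (hp.symm.occ_of_occ_dual ho)))
  · exact hE.extVanish_Δ 0 i fun l hl ho =>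
      hij (lt_of_lt_of_le hl (occ_le_of_occ_Δ (hp.occ_of_occ_dual ho)))

/-- The socle of a costandard module is simple: a map from `Δ(i)°` which is injective on `(L i)°` is
injective. -/
lemma IsDualityPair.injective_of_socle [IsArtinianRing S] (hp : E.IsDualityPair D D')
    {π : E.Δ i →ₗ[S] E.L i} (hπ : Function.Surjective π)
    (hmax : ∀ U : Submodule S (E.Δ i), U ≠ ⊤ → U ≤ LinearMap.ker π)
    {θ : dualObj D' (E.Δ i) →ₗ[S] M} (hθ : Function.Injective (θ ∘ₗ dualMap D' π)) :
    Function.Injective θ := by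
  rw [← LinearMap.ker_eq_bot]
  by_contra hne
  have hn : Nontrivial (FGModuleCat.of S (LinearMap.ker θ)) := Submodule.nontrivial_iff_ne_bot.2 hne
  obtain ⟨j, f, hf⟩ := E.exists_simple_submodule hn
  obtain ⟨e⟩ := hp.simple' j
  -- a simple submodule of the kernel is the dual of a simple quotient of `Δ(i)`
  obtain ⟨g, hg⟩ := dualMap_surjective D' (A := E.Δ i) (B := E.L j)
    ((LinearMap.ker θ).subtype ∘ₗ f ∘ₗ e.toLinearMap)
  have hinj : Function.Injective (dualMap D' g) := by
    rw [hg, LinearMap.coe_comp, LinearMap.coe_comp]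
    exact (LinearMap.ker θ).subtype_injective.comp (hf.comp e.injective)
  have hnt : Nontrivial (dualObj D' (E.L j)) := by
    have := IsSimpleModule.nontrivial S (E.L j)
    exact e.toEquiv.nontrivial
  have hg0 : g ≠ 0 := fun h => by
    have h1 : dualMap D' g = 0 := by
      have := dualMap_sub D' (0 : E.Δ i →ₗ[S] E.L j) 0
      rwa [sub_self, sub_self, ← h] at this
    obtain ⟨x, hx⟩ := exists_ne (0 : dualObj D' (E.L j))
    exact hx (hinj (by rw [h1]; rfl))
  have hco := isCoatom_ker (LinearMap.surjective_of_ne_zero hg0)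
  have hker : LinearMap.ker π = LinearMap.ker g :=
    (hco.le_iff_eq (isCoatom_ker hπ).1).1 (hmax _ hco.1)
  obtain ⟨g', hg'⟩ : ∃ g' : E.L i →ₗ[S] E.L j, g' ∘ₗ π = g :=
    ⟨(LinearMap.ker π).liftQ g hker.le ∘ₗ (π.quotKerEquivOfSurjective hπ).symm.toLinearMap, by
      ext x
      have : (π.quotKerEquivOfSurjective hπ).symm (π x) = Submodule.Quotient.mk x := by
        rw [LinearEquiv.symm_apply_eq]; rfl
      simp [this]⟩
  obtain ⟨x, hx⟩ := exists_ne (0 : dualObj D' (E.L j))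
  have h1 : θ (dualMap D' g x) = 0 := by
    rw [hg]
    exact (f (e x)).2
  rw [← hg', dualMap_comp] at h1
  have h2 : dualMap D' g' x = 0 := hθ (by rw [map_zero]; exact h1)
  refine hx (hinj ?_)
  rw [← hg', dualMap_comp, LinearMap.comp_apply, h2, map_zero, map_zero]

/-- A module `M` with `Ext^n(Δ(i), M) = 0` for all `i` and all `n > 0` has a filtration by
costandard modules, so that its dual has a filtration by standard modules. If `L l` is a simple submodule of
`M` with `l` minimal, then the inclusion extends to an embedding of the costandard module with
socle `L l`. -/
theorem Good.filt_dual [IsArtinianRing S] [Finite Λ] (hp : E.IsDualityPair D D')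
    (hE : E.IsQuasiHereditary) (M : FGModuleCat.{u} S) (hM : E.Good M) :
    E.Filt (fun _ => True) (dualObj D M) := by
  induction hl : Module.length S M using WellFoundedLT.induction generalizing M with
  | ind l ih =>
    rcases subsingleton_or_nontrivial M with hn | hn
    · exact Filt.zero _ (subsingleton_dualObj D hn)
    obtain ⟨i, ⟨ℓ, hℓ⟩, hmin⟩ := (Set.toFinite
      {i : Λ | ∃ f : E.L i →ₗ[S] M, Function.Injective f}).exists_minimal
        (E.exists_simple_submodule hn)
    have hlt : ∀ j, j < i → ∀ f : E.L j →ₗ[S] M, ¬ Function.Injective f := fun j hj f hf =>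
      not_le_of_gt hj (hmin ⟨f, hf⟩ hj.le)
    have hL : ∀ j, j < i → ExtVanish (E.L j) M 1 := fun j hj => by
      obtain ⟨π, hπ, hmax⟩ := hE.exists_top_Δ j
      refine (IsSES.of_surjective hπ).ext_contravariant₃
        (extVanish_zero_iff.2 fun φ => by_contra fun hφ => ?_) (hM 0 j)
      obtain ⟨m, hm, f, hf⟩ := E.exists_occ_of_map_ne_zero hφ
      exact hlt m ((hE.lt_of_occ_radical hπ hmax hm).trans hj) f hf
    obtain ⟨π, hπ, hmax⟩ := hE.exists_top_Δ i
    obtain ⟨e⟩ := hp.simple' i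
    obtain ⟨θ, hθ⟩ := ((IsSES.of_surjective hπ).dual D').exists_extend
      (E.extVanish_of_occ _ fun j hj => hL j
        (hE.lt_of_occ_radical hπ hmax (hp.occ_of_occ_dual hj))) (ℓ ∘ₗ e.toLinearMap)
    have hθi : Function.Injective θ := hp.injective_of_socle hπ hmax <| by
      rw [hθ, LinearMap.coe_comp]
      exact hℓ.comp e.injective
    have hs := IsSES.of_injective hθi
    have hnt : Nontrivial (dualObj D' (E.Δ i)) := by
      by_contra h
      rw [not_nontrivial_iff_subsingleton] at h
      obtain ⟨e⟩ := hp.equiv (E.Δ i)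
      have h1 := subsingleton_dualObj D h
      have h2 := hE.nontrivial_Δ i
      exact not_subsingleton (E.Δ i) e.symm.toEquiv.subsingleton
    obtain ⟨e'⟩ := hp.equiv (E.Δ i)
    refine Filt.ext _ _ (hs.dual D) (ih _ (hl ▸ hs.length_lt hnt) _ (fun n j => ?_) rfl)
      ((Filt.std i trivial).of_equiv e'.symm)
    exact hs.ext_covariant₃ (hM n j) (hp.good_dual_Δ hE i (n + 1) j)

variable (E) in
/-- The `∇`-filtration dimension of `M` is at most `a`. -/
def GfdLE (M : FGModuleCat.{u} S) (a : ℕ) : Prop :=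
  ∀ (n : ℕ) (i : Λ), a ≤ n → ExtVanish (E.Δ i) M (n + 1)

lemma GfdLE.of_isSES {a : ℕ} {f : M →ₗ[S] Y} {g : Y →ₗ[S] X} (h : IsSES f g) (hY : E.Good Y)
    (hM : E.GfdLE M (a + 1)) : E.GfdLE X a := fun n i hn =>
  h.ext_covariant₃ (hY n i) (hM (n + 1) i (by lia))

/-- The upper bound `Ext^n(N°, M) = 0` for `n > gfd N + gfd M`. -/
theorem extVanish_dual_of_gfdLE (k : Type*) [Field k] [Algebra k S] [FiniteDimensional k S]
    [IsArtinianRing S] [Finite Λ] (hp : E.IsDualityPair D D') (hE : E.IsQuasiHereditary)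
    {b : ℕ} (hM : E.GfdLE M b) (a : ℕ) : ∀ N, E.GfdLE N a → ∀ n, a + b ≤ n →
      ExtVanish (dualObj D N) M (n + 1) := by
  induction a with
  | zero =>
    intro N hN n hn
    exact (Good.filt_dual hp hE N fun n i => hN n i (Nat.zero_le _)).extVanish
      fun i _ => hM n i (by lia)
  | succ a ih =>
    intro N hN n hn
    obtain ⟨Y, X, f, g, hfg, hY, hX⟩ := hE.exists_approximation k N
    obtain ⟨n, rfl⟩ : ∃ m, n = m + 1 := ⟨n - 1, by lia⟩
    refine (hfg.dual D).ext_contravariant₃ (ih X (hN.of_isSES hfg hY) n (by lia)) ?_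
    exact (Good.filt_dual hp hE Y hY).extVanish fun i _ => hM (n + 1) i (by lia)

end

end SimpleLabelling

/-! ### Minimal approximations -/

section Fitting

variable {S : Type u} [Ring S]

/-- Fitting's lemma: an endomorphism with a nonzero fixed vector has a right multiple which is a
nonzero idempotent. -/
lemma exists_idempotent_of_fixed {M : Type*} [AddCommGroup M] [Module S M] [IsArtinian S M]
    [IsNoetherian S M] (e : Module.End S M) {x : M} (hx : x ≠ 0) (hex : e x = x) :
    ∃ θ : Module.End S M, (e * θ) * (e * θ) = e * θ ∧ e * θ ≠ 0 := by
  obtain ⟨n, hn⟩ := Filter.eventually_atTop.1 e.eventually_isCompl_ker_pow_range_pow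
  have hc := hn (n + 1) n.le_succ
  set F := e ^ (n + 1) with hF
  set U := LinearMap.range F
  have hmem : ∀ u ∈ U, F u ∈ U := fun u _ => ⟨u, rfl⟩
  let G : U →ₗ[S] U := F.restrict hmem
  have hinj : Function.Injective G := (injective_iff_map_eq_zero G).2 fun u hu =>
    Subtype.ext (hc.disjoint.le_bot ⟨congrArg Subtype.val hu, u.2⟩)
  let G' : U ≃ₗ[S] U := LinearEquiv.ofBijective G
    ⟨hinj, IsArtinian.surjective_of_injective_endomorphism G hinj⟩
  let pr : M →ₗ[S] U := Submodule.projectionOnto U (LinearMap.ker F) hc.symm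
  have key : ∀ y, F (G'.symm (pr y)) = pr y := fun y =>
    congrArg Subtype.val (G'.apply_symm_apply (pr y))
  have hpr : ∀ u : U, pr u = u := fun u => Submodule.projectionOnto_apply_left hc.symm u
  refine ⟨e ^ n * (U.subtype ∘ₗ G'.symm.toLinearMap ∘ₗ pr), ?_⟩
  have hval : e * (e ^ n * (U.subtype ∘ₗ G'.symm.toLinearMap ∘ₗ pr)) = U.subtype ∘ₗ pr := by
    rw [← mul_assoc, ← pow_succ', ← hF]
    exact LinearMap.ext key
  rw [hval]
  refine ⟨LinearMap.ext fun y => congrArg Subtype.val (hpr (pr y)), fun h0 => hx ?_⟩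
  have hxU : x ∈ U := by
    have : ∀ m, (e ^ m) x = x := fun m => by
      induction m with
      | zero => rfl
      | succ m ih => rw [pow_succ, Module.End.mul_apply, hex, ih]
    exact ⟨x, this _⟩
  have h1 : ((pr x : U) : M) = 0 := LinearMap.congr_fun h0 x
  rw [← h1, hpr ⟨x, hxU⟩]

/-- If `1 - ba` is injective, then so is `1 - ab`. -/
lemma injective_one_sub_swap {A B : Type*} [AddCommGroup A] [Module S A] [AddCommGroup B]
    [Module S B] {a : A →ₗ[S] B} {b : B →ₗ[S] A}
    (h : ∀ x, b (a x) = x → x = 0) : ∀ y, a (b y) = y → y = 0 := fun y hy => by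
  rw [← hy, h (b y) (congrArg b hy), map_zero]

end Fitting

namespace SimpleLabelling

variable {S : Type u} [Ring S] {Λ : Type*} [PartialOrder Λ] {E : SimpleLabelling S Λ}
  {i j : Λ} {A B C M N X Y Q : FGModuleCat.{u} S} {n : ℕ}
  {D D' : (FGModuleCat.{u} S)ᵒᵖ ≌ FGModuleCat.{u} S}

variable (E) in
/-- The left orthogonal of the modules with costandard filtrations. -/
def CoGood (X : FGModuleCat.{u} S) : Prop :=
  ∀ Y, E.Good Y → ∀ n, ExtVanish X Y (n + 1)

variable (E) in
/-- An embedding of `M` into a module `Y` with a costandard filtration whose cokernel `Q` is left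
orthogonal to such modules. -/
structure IsApprox (f : M →ₗ[S] Y) (p : Y →ₗ[S] Q) : Prop where
  ses : IsSES f p
  good : E.Good Y
  coGood : E.CoGood Q

/-- If `1 - pu` is not injective for some `u`, then a common direct summand of `Y` and `Q` can be
split off. -/
lemma IsApprox.exists_smaller [IsArtinianRing S] {f : M →ₗ[S] Y} {p : Y →ₗ[S] Q}
    (h : E.IsApprox f p) {u : Q →ₗ[S] Y} {x : Q} (hx : x ≠ 0) (hux : p (u x) = x) :
    ∃ (Y' Q' : FGModuleCat.{u} S) (f' : M →ₗ[S] Y') (p' : Y' →ₗ[S] Q'),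
      E.IsApprox f' p' ∧ Module.length S Q' < Module.length S Q := by
  obtain ⟨θ, hid, hne⟩ := exists_idempotent_of_fixed (p ∘ₗ u : Module.End S Q) hx hux
  set π : Module.End S Q := (p ∘ₗ u : Module.End S Q) * θ with hπ
  have hππ : ∀ q, π (π q) = π q := fun q => LinearMap.congr_fun hid q
  let Y' := LinearMap.ker (π ∘ₗ p)
  let Q' := LinearMap.ker π
  have hf : ∀ m, f m ∈ Y' := fun m => by
    rw [LinearMap.mem_ker, LinearMap.comp_apply, h.ses.exact.apply_apply_eq_zero, map_zero]
  have hp : ∀ y : Y', p y ∈ Q' := fun y => y.2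
  let w : Q →ₗ[S] Y := u ∘ₗ θ ∘ₗ π
  have hw : ∀ q, p (w q) = π q := hππ
  have hrY : ∀ y, y - w (p y) ∈ Y' := fun y => by
    rw [LinearMap.mem_ker, LinearMap.comp_apply, map_sub, map_sub, hw, hππ, sub_self]
  have hrQ : ∀ q, q - π q ∈ Q' := fun q => by
    rw [LinearMap.mem_ker, map_sub, hππ, sub_self]
  refine ⟨FGModuleCat.of S Y', FGModuleCat.of S Q', f.codRestrict Y' hf,
    (p ∘ₗ Y'.subtype).codRestrict Q' hp, ⟨⟨?_, ?_, ?_⟩, fun n i => ?_, fun W hW n => ?_⟩,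
    Submodule.length_lt fun h => hne (LinearMap.ker_eq_top.1 h)⟩
  · exact fun a b hab => h.ses.inj (congrArg Subtype.val hab)
  · intro y
    constructor
    · intro hy
      obtain ⟨m, hm⟩ := (h.ses.exact y.1).1 (congrArg Subtype.val hy)
      exact ⟨m, Subtype.ext hm⟩
    · rintro ⟨m, rfl⟩
      exact Subtype.ext (h.ses.exact.apply_apply_eq_zero m)
  · intro q
    obtain ⟨y, hy⟩ := h.ses.surj q.1
    refine ⟨⟨y, ?_⟩, Subtype.ext hy⟩
    rw [LinearMap.mem_ker, LinearMap.comp_apply, hy]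
    exact q.2
  · refine extVanish_retract_right (A := FGModuleCat.of S Y') Y'.subtype
      ((LinearMap.id - w ∘ₗ p).codRestrict Y' hrY) (LinearMap.ext fun y => Subtype.ext ?_)
      (h.good n i)
    have h1 : π (p y.1) = 0 := y.2
    change y.1 - u (θ (π (p y.1))) = y.1
    rw [h1, map_zero, map_zero, sub_zero]
  · refine extVanish_retract_left (A := FGModuleCat.of S Q') Q'.subtype
      ((LinearMap.id - π).codRestrict Q' hrQ) (LinearMap.ext fun q => Subtype.ext ?_)
      (h.coGood W hW n)
    have h1 : π q.1 = 0 := q.2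
    change q.1 - π q.1 = q.1
    rw [h1, sub_zero]

/-- Every module `M` has an approximation for which `p` is a radical map. -/
lemma IsQuasiHereditary.exists_minimal_approx (k : Type*) [Field k] [Algebra k S]
    [FiniteDimensional k S] [IsArtinianRing S] [Finite Λ] (hE : E.IsQuasiHereditary)
    (M : FGModuleCat.{u} S) :
    ∃ (Y Q : FGModuleCat.{u} S) (f : M →ₗ[S] Y) (p : Y →ₗ[S] Q),
      E.IsApprox f p ∧ ∀ u : Q →ₗ[S] Y, ∀ x, p (u x) = x → x = 0 := by
  obtain ⟨Y₀, Q₀, f₀, p₀, h₀, hY₀, hQ₀⟩ := hE.exists_approximation k M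
  have h : E.IsApprox f₀ p₀ := ⟨h₀, hY₀, fun W hW n => hW.extVanish hQ₀ n⟩
  clear h₀ hY₀ hQ₀
  induction hl : Module.length S Q₀ using WellFoundedLT.induction generalizing Y₀ Q₀ with
  | ind l ih =>
    by_cases hmin : ∀ u : Q₀ →ₗ[S] Y₀, ∀ x, p₀ (u x) = x → x = 0
    · exact ⟨Y₀, Q₀, f₀, p₀, h, hmin⟩
    · push Not at hmin
      obtain ⟨u, x, hux, hx⟩ := hmin
      obtain ⟨Y', Q', f', p', h', hlt⟩ := h.exists_smaller hx hux
      exact ih _ (hl ▸ hlt) Y' Q' f' p' h' rfl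

/-! ### Maximal composition factors -/

lemma IsQuasiHereditary.occ_Δ_self (hE : E.IsQuasiHereditary) (i : Λ) : E.Occ i (E.Δ i) := by
  obtain ⟨π, hπ, -⟩ := hE.exists_top_Δ i
  have hi : E.Occ i (E.L i) := ⟨_, cov_ne_zero⟩
  exact hi.of_surjective hπ

/-- If `L i` is a maximal composition factor of a module `X` with a standard filtration, then `X`
has a standard filtration that starts with `Δ(i)`. -/
lemma Filt.exists_of_maximal [IsNoetherianRing S] (hE : E.IsQuasiHereditary) {R : Λ → Prop}
    (h : E.Filt R X) (hi : E.Occ i X) (hmax : ∀ j, i < j → ¬ E.Occ j X) :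
    ∃ (Z : FGModuleCat.{u} S) (ι : E.Δ i →ₗ[S] X) (q : X →ₗ[S] Z),
      IsSES ι q ∧ E.Filt (fun _ => True) Z := by
  induction h with
  | zero M hM =>
    obtain ⟨f, hf⟩ := hi
    exact absurd (LinearMap.ext fun x => Subsingleton.elim _ _) hf
  | std m hm =>
    obtain rfl : i = m := (occ_le_of_occ_Δ hi).eq_of_not_lt fun hlt => hmax m hlt (hE.occ_Δ_self m)
    exact ⟨_, _, _, IsSES.of_equiv_zero (LinearEquiv.refl S (E.Δ i)),
      Filt.zero _ (inferInstanceAs (Subsingleton PUnit))⟩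
  | @ext A B C f g hfg hA hC ihA ihC =>
    by_cases hiC : E.Occ i C
    · obtain ⟨Z, ι', q', hs, hZ⟩ := ihC hiC fun j hj ho => hmax j hj (ho.of_surjective hfg.surj)
      obtain ⟨ι, rfl⟩ := hfg.exists_lift
        (hE.extVanish_Δ 0 i fun j hj ho => hmax j hj (ho.of_injective hfg.inj)) ι'
      have hι : Function.Injective ι := by
        have := hs.inj
        rw [LinearMap.coe_comp] at this
        exact this.of_comp
      have hι' := IsSES.of_injective hι
      have hle : LinearMap.range ι ≤ LinearMap.ker (q' ∘ₗ g) := by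
        rintro _ ⟨x, rfl⟩
        exact hs.exact.apply_apply_eq_zero x
      refine ⟨_, ι, _, hι', Filt.ext ((LinearMap.range ι).mkQ ∘ₗ f)
        ((LinearMap.range ι).liftQ (q' ∘ₗ g) hle) ⟨?_, ?_, ?_⟩
        (hA.mono fun _ _ => trivial) hZ⟩
      · refine (injective_iff_map_eq_zero _).2 fun a ha => ?_
        obtain ⟨x, hx⟩ := (Submodule.Quotient.mk_eq_zero _).1 ha
        have h0 : g (ι x) = 0 := by rw [hx]; exact hfg.exact.apply_apply_eq_zero a
        have hx0 : x = 0 := hs.inj (by rw [map_zero]; exact h0)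
        exact hfg.inj (by rw [← hx, hx0, map_zero, map_zero])
      · intro y
        obtain ⟨b, rfl⟩ := Submodule.mkQ_surjective _ y
        constructor
        · intro hb
          obtain ⟨x, hx⟩ := (hs.exact (g b)).1 hb
          obtain ⟨a, ha⟩ := (hfg.exact (b - ι x)).1 (by
            rw [map_sub, ← hx]; exact sub_self _)
          refine ⟨a, (Submodule.Quotient.eq _).2 ⟨-x, ?_⟩⟩
          rw [ha, map_neg]
          abel
        · rintro ⟨a, ha⟩
          rw [← ha]
          change q' (g (f a)) = 0
          rw [hfg.exact.apply_apply_eq_zero, map_zero]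
      · intro z
        obtain ⟨c, rfl⟩ := hs.surj z
        obtain ⟨b, rfl⟩ := hfg.surj c
        exact ⟨Submodule.Quotient.mk b, rfl⟩
    · obtain ⟨Z, ι, q, hs, hZ⟩ := ihA ((hi.of_isSES hfg).resolve_right hiC)
        fun j hj ho => hmax j hj (ho.of_injective hfg.inj)
      obtain ⟨Z', r, s, t, hr, hst⟩ := hs.exists_comp hfg
      exact ⟨Z', _, r, hr, Filt.ext s t hst hZ (hC.mono fun _ _ => trivial)⟩

/-! ### Nonvanishing in the top degree -/

/-- If `Ext²(M°, M) = 0`, then every map `Q° → Q` is a sum of a map that factors through `p` and a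
map that factors through `p°`. -/
lemma exists_decomposition [IsNoetherianRing S] {f : M →ₗ[S] Y} {p : Y →ₗ[S] Q} (h : IsSES f p)
    (hM : ExtVanish (dualObj D M) M 2) (hY : ExtVanish (dualObj D Y) Y 1)
    (α : dualObj D Q →ₗ[S] Q) :
    ∃ (u : dualObj D Q →ₗ[S] Y) (v : dualObj D Y →ₗ[S] Q), α = p ∘ₗ u + v ∘ₗ dualMap D p := by
  have hd := h.dual D
  let α' : (dualObj D Q).obj ⟶ h.shortComplex.X₃ := ModuleCat.ofHom α
  let x := (Abelian.Ext.mk₀ α').comp h.shortExact.extClass (zero_add 1)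
  obtain ⟨y, hy⟩ := Abelian.Ext.contravariant_sequence_exact₁ hd.shortExact M.obj x
    (n₁ := 2) rfl (Subsingleton.elim (h := hM) _ _)
  obtain ⟨z, hz⟩ := Abelian.Ext.covariant_sequence_exact₁ (dualObj D Y).obj h.shortExact y
    (Subsingleton.elim (h := hY) _ _) (n₀ := 0) rfl
  obtain ⟨v, rfl⟩ := (Abelian.Ext.mk₀_bijective _ _).2 z
  have hzero : (Abelian.Ext.mk₀ (α' - hd.shortComplex.f ≫ v)).comp h.shortExact.extClass
      (zero_add 1) = 0 := by
    rw [sub_eq_add_neg, Abelian.Ext.mk₀_add, Abelian.Ext.mk₀_neg, Abelian.Ext.add_comp,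
      Abelian.Ext.neg_comp, ← Abelian.Ext.mk₀_comp_mk₀_assoc, hz, hy]
    exact add_neg_cancel x
  obtain ⟨w, hw⟩ := Abelian.Ext.covariant_sequence_exact₃ (dualObj D Q).obj h.shortExact
    (Abelian.Ext.mk₀ (α' - hd.shortComplex.f ≫ v)) (n₁ := 1) rfl hzero
  obtain ⟨u, rfl⟩ := (Abelian.Ext.mk₀_bijective _ _).2 w
  rw [Abelian.Ext.mk₀_comp_mk₀] at hw
  have h1 := congrArg ModuleCat.Hom.hom ((Abelian.Ext.mk₀_bijective _ _).1 hw)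
  refine ⟨u.hom, v.hom, ?_⟩
  have h2 : p ∘ₗ u.hom = α - v.hom ∘ₗ dualMap D p := h1
  rw [h2, sub_add_cancel]

end SimpleLabelling

namespace SimpleLabelling

variable {S : Type u} [Ring S] {Λ : Type*} [PartialOrder Λ] {E : SimpleLabelling S Λ}
  {i j : Λ} {A B C M N X Y Q : FGModuleCat.{u} S} {n : ℕ}
  {D D' : (FGModuleCat.{u} S)ᵒᵖ ≌ FGModuleCat.{u} S}

/-- A nonzero module `Q` with a standard and a costandard filtration and its dual have an
indecomposable summand in common: there are maps `α : Q° → Q` and `β : Q → Q°` such that `αβ` has a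
nonzero fixed vector. -/
lemma exists_fixed_comp [IsArtinianRing S] [Finite Λ] (hp : E.IsDualityPair D D')
    (hE : E.IsQuasiHereditary) (hQ : Nontrivial Q) (hgood : E.Good Q) (hco : E.CoGood Q) :
    ∃ (α : dualObj D Q →ₗ[S] Q) (β : Q →ₗ[S] dualObj D Q) (x : Q), x ≠ 0 ∧ α (β x) = x := by
  have hfD : E.Filt (fun _ => True) (dualObj D Q) := hgood.filt_dual hp hE
  have hgD : E.Good (dualObj D Q) := hE.good_of_ext_one fun i =>
    hp.symm.extVanish_one (hco _ (hp.good_dual_Δ hE i) 0)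
  obtain ⟨e⟩ := hp.equiv' Q
  have hf : E.Filt (fun _ => True) Q := (hgD.filt_dual hp.symm hE).of_equiv e
  -- a maximal composition factor of `Q`
  obtain ⟨j, f, hj⟩ := E.exists_simple_submodule hQ
  obtain ⟨i, hi, hmax⟩ := (Set.toFinite {i : Λ | E.Occ i Q}).exists_maximal
    ⟨j, Occ.of_injective ⟨_, cov_ne_zero⟩ hj⟩
  have hmax' : ∀ j, i < j → ¬ E.Occ j Q := fun j hj ho => not_le_of_gt hj (hmax ho hj.le)
  obtain ⟨Z, ι, q, hs, hZ⟩ := hf.exists_of_maximal hE hi hmax'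
  obtain ⟨Z', ι', q', hs', hZ'⟩ := hfD.exists_of_maximal hE (hi.dual hp.simple)
    fun j hj ho => hmax' j hj (hp.symm.occ_of_occ_dual ho)
  obtain ⟨α, hα⟩ := hs'.exists_extend (hgood.extVanish hZ' 0) ι
  obtain ⟨β, hβ⟩ := hs.exists_extend (hgD.extVanish hZ 0) ι'
  have := hE.nontrivial_Δ i
  obtain ⟨x, hx⟩ := exists_ne (0 : E.Δ i)
  refine ⟨α, β, ι x, fun h => hx (hs.inj (by rw [h, map_zero])), ?_⟩
  have h1 : β (ι x) = ι' x := LinearMap.congr_fun hβ x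
  rw [h1]
  exact LinearMap.congr_fun hα x

/-- The case of `∇`-filtration dimension one. -/
theorem not_extVanish_two (k : Type*) [Field k] [Algebra k S] [FiniteDimensional k S]
    [IsArtinianRing S] [Finite Λ] (hp : E.IsDualityPair D D') (hE : E.IsQuasiHereditary)
    (hM : E.GfdLE M 1) (hne : ¬ E.Good M) : ¬ ExtVanish (dualObj D M) M 2 := by
  intro hvan
  obtain ⟨Y, Q, f, p, ⟨hs, hY, hQ⟩, hmin⟩ := hE.exists_minimal_approx k M
  have hn : Nontrivial Q := by
    by_contra h
    rw [not_nontrivial_iff_subsingleton] at h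
    refine hne (hY.of_equiv (LinearEquiv.ofBijective f ⟨hs.inj, fun y => ?_⟩).symm)
    exact (hs.exact y).1 (Subsingleton.elim _ _)
  have hgQ : E.Good Q := fun n i => GfdLE.of_isSES hs hY hM n i (Nat.zero_le n)
  obtain ⟨α, β, x, hx, hαβ⟩ := exists_fixed_comp hp hE hn hgQ hQ
  obtain ⟨u, v, rfl⟩ := exists_decomposition hs hvan
    (hY.extVanish (hY.filt_dual hp hE) 0) α
  -- `1 - pw` is bijective for every `w`, and so is its dual
  have hbij : ∀ w : Q →ₗ[S] Y, Function.Bijective (LinearMap.id - p ∘ₗ w : Q →ₗ[S] Q) := fun w => by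
    have hinj : Function.Injective (LinearMap.id - p ∘ₗ w : Q →ₗ[S] Q) :=
      (injective_iff_map_eq_zero _).2 fun y hy => hmin w y (sub_eq_zero.1 hy).symm
    exact ⟨hinj, IsArtinian.surjective_of_injective_endomorphism _ hinj⟩
  have hdual : ∀ z : dualObj D Y →ₗ[S] dualObj D Q, ∀ y, z (dualMap D p y) = y → y = 0 := by
    intro z y hy
    obtain ⟨w, rfl⟩ := dualMap_surjective D z
    refine dualMap_injective_of_surjective D (hbij w).2 ?_
    rw [dualMap_sub, dualMap_id, dualMap_comp, map_zero]
    exact sub_eq_zero.2 hy.symm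
  let g : Q ≃ₗ[S] Q := LinearEquiv.ofBijective _ (hbij (u ∘ₗ β))
  -- `1 - αβ = g (1 - g⁻¹ v p° β)` is a composition of injective maps
  refine hx (injective_one_sub_swap (a := g.symm.toLinearMap ∘ₗ v ∘ₗ dualMap D p) (b := β)
    (fun y hy => hdual (β ∘ₗ g.symm.toLinearMap ∘ₗ v) y hy) x ?_)
  change g.symm (v (dualMap D p (β x))) = x
  rw [LinearEquiv.symm_apply_eq]
  change _ = x - p (u (β x))
  rw [eq_sub_iff_add_eq']
  exact hαβ

/-- If `d > 0` is the `∇`-filtration dimension of `M`, then `Ext^{2d}(M°, M) ≠ 0`. -/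
theorem not_extVanish_two_mul (k : Type*) [Field k] [Algebra k S] [FiniteDimensional k S]
    [IsArtinianRing S] [Finite Λ] (hp : E.IsDualityPair D D') (hE : E.IsQuasiHereditary) (d : ℕ) :
    ∀ M, E.GfdLE M (d + 1) → (∃ i, ¬ ExtVanish (E.Δ i) M (d + 1)) →
      ¬ ExtVanish (dualObj D M) M (2 * (d + 1)) := by
  induction d with
  | zero =>
    rintro M hM ⟨i, hi⟩
    exact not_extVanish_two k hp hE hM fun h => hi (h 0 i)
  | succ d ih =>
    rintro M hM ⟨i, hi⟩ hvan
    obtain ⟨Y, X, f, g, hfg, hY, -⟩ := hE.exists_approximation k M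
    have hX : E.GfdLE X (d + 1) := hM.of_isSES hfg hY
    refine ih X hX ⟨i, fun h => hi (hfg.ext_covariant₁ h (hY (d + 1) i))⟩ ?_
    have h1 : ExtVanish (dualObj D X) M (2 * d + 3) :=
      (hfg.dual D).ext_contravariant₁
        ((hY.filt_dual hp hE).extVanish fun i _ => hM (2 * d + 2) i (by lia)) hvan
    exact hfg.ext_covariant₃
      (extVanish_dual_of_gfdLE k hp hE (b := 0) (fun n i _ => hY n i) (d + 1) X hX (2 * d + 1)
        (by lia)) h1

/-! ### Dimensions -/

lemma le_gfd_of_not_extVanish (h : ¬ ExtVanish (E.Δ i) M n) : (n : ℕ∞) ≤ E.gfd M :=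
  le_iSup₂_of_le (f := fun (d : ℕ) (_ : ∃ i, Nontrivial (Abelian.Ext (E.Δ i).obj M.obj d)) =>
    (d : ℕ∞)) n ⟨i, not_subsingleton_iff_nontrivial.1 h⟩ le_rfl

lemma gfdLE_of_gfd_le {d : ℕ} (h : E.gfd M ≤ d) : E.GfdLE M d := fun n i hn => by
  by_contra h0
  have := (le_gfd_of_not_extVanish h0).trans h
  rw [Nat.cast_le] at this
  lia

lemma exists_not_extVanish_of_gfd_eq {d : ℕ} (h : E.gfd M = (d + 1 : ℕ)) :
    ∃ i, ¬ ExtVanish (E.Δ i) M (d + 1) := by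
  by_contra! h0
  have hle : E.gfd M ≤ d := iSup₂_le fun n hn => by
    obtain ⟨i, hi⟩ := hn
    have hi' := not_subsingleton_iff_nontrivial.2 hi
    have h1 := le_gfd_of_not_extVanish hi'
    rw [h, Nat.cast_le] at h1
    have h2 : n ≠ d + 1 := fun h => hi' (h ▸ h0 i)
    rw [Nat.cast_le]
    lia
  rw [h, Nat.cast_le] at hle
  lia

/-- Every nonzero module `M` satisfies `Ext^{2d}(M°, M) ≠ 0`, where `d` is its `∇`-filtration
dimension. -/
theorem not_extVanish_of_gfd_eq (k : Type*) [Field k] [Algebra k S] [FiniteDimensional k S]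
    [IsArtinianRing S] [Finite Λ] (hp : E.IsDualityPair D D') (hE : E.IsQuasiHereditary)
    (hM : Nontrivial M) {d : ℕ} (hd : E.gfd M = d) : ¬ ExtVanish (dualObj D M) M (2 * d) := by
  cases d with
  | zero =>
    -- a simple submodule of `M` is a quotient of `M°`
    intro h
    obtain ⟨j, f, hf⟩ := E.exists_simple_submodule hM
    obtain ⟨e⟩ := hp.simple j
    have h0 : f ∘ₗ e.toLinearMap ∘ₗ dualMap D f = 0 := extVanish_zero_iff.1 h _
    have := IsSimpleModule.nontrivial S (E.L j)
    obtain ⟨x, hx⟩ := exists_ne (0 : E.L j)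
    obtain ⟨y, rfl⟩ := (e.surjective.comp (dualMap_surjective_of_injective D hf)) x
    exact hx (hf (by rw [map_zero]; exact LinearMap.congr_fun h0 y))
  | succ d =>
    exact not_extVanish_two_mul k hp hE d M (gfdLE_of_gfd_le hd.le)
      (exists_not_extVanish_of_gfd_eq hd)

omit [PartialOrder Λ] in
/-- The projective dimension of a finitely generated module is detected by finitely generated
modules. -/
lemma hasProjectiveDimensionLT_of_extVanish [IsNoetherianRing S] (m : ℕ) :
    ∀ N : FGModuleCat.{u} S, (∀ M : FGModuleCat.{u} S, ExtVanish N M (m + 1)) →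
      HasProjectiveDimensionLT N.obj (m + 1) := by
  induction m with
  | zero =>
    intro N h
    obtain ⟨K, P, f, g, hP, hfg⟩ := exists_projective_presentation N
    obtain ⟨s, hs⟩ := hfg.exists_lift (h K) LinearMap.id
    have : Module.Projective S N := Module.Projective.of_split s g hs
    have : Projective N.obj := (IsProjective.iff_projective N).1 this
    exact projective_iff_hasProjectiveDimensionLT_one.1 this
  | succ m ih =>
    intro N h
    obtain ⟨K, P, f, g, hP, hfg⟩ := exists_projective_presentation N
    have hK := ih K fun M => hfg.ext_contravariant₁ extVanish_of_projective (h M)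
    have hP' : Projective P.obj := (IsProjective.iff_projective P).1 hP
    exact (hfg.shortExact.hasProjectiveDimensionLT_X₃_iff m hP').2 hK

omit [PartialOrder Λ] in
lemma le_globalDim_of_not_extVanish (h : ¬ ExtVanish N M n) :
    ((n : ℕ∞) : WithBot ℕ∞) ≤ globalDim S :=
  ((projectiveDimension_ge_iff N.obj n).2 fun _ =>
    h (HasProjectiveDimensionLT.subsingleton N.obj n n le_rfl M.obj)).trans
      (le_iSup (fun N : FGModuleCat.{u} S => projectiveDimension N.obj) N)

/-- The global dimension of a quasi-hereditary algebra with a simple-preserving duality is twice its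
`∇`-filtration dimension. -/
theorem globalDim_eq_two_mul_algGfd (k : Type*) [Field k] [Algebra k S] [FiniteDimensional k S]
    [IsArtinianRing S] [Nontrivial S] [Finite Λ] (hp : E.IsDualityPair D D')
    (hE : E.IsQuasiHereditary) : globalDim S = ((2 * E.algGfd : ℕ∞) : WithBot ℕ∞) := by
  apply le_antisymm
  · generalize hg : E.algGfd = g
    induction g using ENat.recTopCoe with
    | top => simp
    | coe g =>
      refine iSup_le fun N => ?_
      have hle : ∀ M, E.GfdLE M g := fun M => gfdLE_of_gfd_le (hg ▸ le_iSup E.gfd M)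
      obtain ⟨e⟩ := hp.equiv N
      have := hasProjectiveDimensionLT_of_extVanish (2 * g) N fun M =>
        extVanish_of_equiv_left e
          (extVanish_dual_of_gfdLE k hp hE (hle M) g (dualObj D' N) (hle _) (2 * g) (by lia))
      exact_mod_cast (projectiveDimension_le_iff N.obj (2 * g)).2 this
  · have h0 : ((0 : ℕ∞) : WithBot ℕ∞) ≤ globalDim S := by
      have hS : ¬ ExtVanish (FGModuleCat.of S S) (FGModuleCat.of S S) 0 := fun h =>
        one_ne_zero (α := S) (LinearMap.congr_fun (extVanish_zero_iff.1 h LinearMap.id) (1 : S))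
      exact le_globalDim_of_not_extVanish hS
    obtain ⟨G, hG⟩ := WithBot.ne_bot_iff_exists.1
      (fun h : globalDim S = ⊥ => by rw [h] at h0; exact absurd h0 (by simp))
    rw [← hG, WithBot.coe_le_coe]
    have hGle : ∀ {N M : FGModuleCat.{u} S} {n : ℕ}, ¬ ExtVanish N M n → (n : ℕ∞) ≤ G := fun h =>
      WithBot.coe_le_coe.1 (hG ▸ le_globalDim_of_not_extVanish h)
    have hM : ∀ M, 2 * E.gfd M ≤ G := fun M => by
      rcases subsingleton_or_nontrivial M with hn | hn
      · have : E.gfd M = 0 := le_antisymm (iSup₂_le fun n hn' => by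
          obtain ⟨i, hi⟩ := hn'
          exact absurd (extVanish_of_subsingleton_right hn) (not_subsingleton_iff_nontrivial.2 hi))
            (zero_le)
        rw [this, mul_zero]
        exact zero_le
      · generalize hd : E.gfd M = d
        induction d using ENat.recTopCoe with
        | top =>
          -- here `Ext^n(Δ(i), M) ≠ 0` for arbitrarily large `n`
          have : (⊤ : ℕ∞) ≤ G := hd ▸ iSup₂_le fun n hn' => by
            obtain ⟨i, hi⟩ := hn'
            exact hGle (not_subsingleton_iff_nontrivial.2 hi)
          rw [top_le_iff.1 this]
          exact le_top
        | coe d => exact_mod_cast hGle (not_extVanish_of_gfd_eq k hp hE hn hd)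
    rw [algGfd, ENat.mul_iSup]
    exact iSup_le hM

end SimpleLabelling

end QuasiHereditary

theorem mainTheorem5 {k : Type*} [Field k] {S : Type u} [Ring S] [Nontrivial S] [Algebra k S]
    [FiniteDimensional k S] {Λ : Type*} [Fintype Λ] [PartialOrder Λ]
    (E : QuasiHereditary.SimpleLabelling S Λ) (hE : E.IsQuasiHereditary)
    (D : (FGModuleCat.{u} S)ᵒᵖ ≌ FGModuleCat.{u} S)
    (hD : ∀ i, Nonempty (D.functor.obj (Opposite.op (E.L i)) ≅ E.L i))
    (hA : E.PropertyA) :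
    (∀ e : Fin 4 ≃ Λ,
      E.gfd (E.L (e 0)) = 0 → E.gfd (E.L (e 1)) = 1 →
      E.gfd (E.L (e 2)) = 1 → E.gfd (E.L (e 3)) = 2 →
        Nontrivial (Abelian.Ext (E.L (e 3)).obj (E.L (e 3)).obj 4) ∧
        QuasiHereditary.globalDim S = ((2 * E.algGfd : ℕ∞) : WithBot ℕ∞) ∧
        ∀ (M : FGModuleCat.{u} S) (d : ℕ), Nontrivial M → E.gfd M = d →
          Nontrivial (Abelian.Ext (D.functor.obj (Opposite.op M)).obj M.obj (2 * d))) ∧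
    (QuasiHereditary.globalDim S ≠ ((2 * E.algGfd : ℕ∞) : WithBot ℕ∞) → 5 ≤ Fintype.card Λ) := by
  have : IsArtinianRing S := IsArtinianRing.of_finite k S
  have hp := QuasiHereditary.SimpleLabelling.isDualityPair_dualInverse (E := E) (D := D) fun i =>
    (hD i).map FGModuleCat.isoToLinearEquiv
  have hext : ∀ (M : FGModuleCat.{u} S) (d : ℕ), Nontrivial M → E.gfd M = d →
      Nontrivial (Abelian.Ext (D.functor.obj (Opposite.op M)).obj M.obj (2 * d)) :=
    fun M d hM hd => not_subsingleton_iff_nontrivial.1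
      (QuasiHereditary.SimpleLabelling.not_extVanish_of_gfd_eq k hp hE hM hd)
  have hgl := QuasiHereditary.SimpleLabelling.globalDim_eq_two_mul_algGfd k hp hE
  refine ⟨fun e _ _ _ h3 => ⟨?_, hgl, hext⟩, fun h => absurd hgl h⟩
  obtain ⟨φ⟩ := hp.simple (e 3)
  refine not_subsingleton_iff_nontrivial.1 fun h =>
    QuasiHereditary.SimpleLabelling.not_extVanish_of_gfd_eq k hp hE
      (IsSimpleModule.nontrivial S (E.L (e 3))) (d := 2) h3
      (QuasiHereditary.extVanish_of_equiv_left φ.symm h)
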